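/- Let $1\le n$ and $[n]=\{1,\dots,n\}$. A plane permutation on $[n]$ is a pair $(s,\pi)$, where $s$ is an $n$-cycle on $[n]$ (the identity if $n=1$) and $\pi$ is an arbitrary permutation of $[n]$; $\pi$ is called its vertical, and the permutation $s\circ\pi^{-1}$ its diagonal. For a partition $\lambda\vdash n$ let $\ell(\lambda)$ be its number of parts. Cycle-types and numbers of cycles take fixed points into account as cycles of length $1$. For integers $0\le m\le n$ and $k\ge 0$ let $I^{\lambda}_{m,k}$ be the number of plane permutations on $[n]$ whose diagonal has cycle-type $\lambda$ and whose vertical has exactly $k$ cycles and fixes every element of $[m]=\{1,\dots,m\}$. For $\mu,\lambda\vdash n$ write $\mu\rhd_{r}\lambda$ if $\mu$ can be obtained from $\lambda$ by splitting one part of $\lambda$ into $r$ (positive) parts, and in that case let $\kappa_{\mu,\lambda}$ be the number of ways of choosing $r$ parts of $\mu$ such that merging them into one part yields $\lambda$, where different parts of $\mu$ are distinguished even if they have the same value. Theorem. For every $\lambda\vdash n$, $0\le m\le n$ and $k\ge 0$ with $n+1-\ell(\lambda)-k>0$, $$ I^{\lambda}_{m,k}=\frac{\displaystyle\sum_{j\ge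 1}\binom{k+2j-m}{2j+1}\,I^{\lambda}_{m,k+2j}+\sum_{j\ge 1}\ \sum_{\mu\,\rhd_{2j+1}\,\lambda}\kappa_{\mu,\lambda}\,I^{\mu}_{m,k}}{n+1-\ell(\lambda)-k}. $$ (Both sums over $j$ are finite: all terms with $j>n$ are zero. Also $I^{\lambda}_{m,k+2j}=0$ whenever $k+2j<m$, so the binomial coefficient matters only when $k+2j\ge m$.) -/

import Mathlib

/-- The number of cycles of a permutation of `[n]`; fixed points count as cycles of length one. -/
def numCycles {n : ℕ} (π : Equiv.Perm (Fin n)) : ℕ :=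
  π.partition.parts.card

/-- `π` has cycle-type `lam`, fixed points being recorded as parts equal to one. -/
def HasCycleType {n : ℕ} (π : Equiv.Perm (Fin n)) (lam : n.Partition) : Prop :=
  π.partition.parts = lam.parts

/-- A plane permutation on `[n]`: a pair `(s, π)` where `s` is an `n`-cycle
and `π` is an arbitrary permutation. (The `1`-cycle on `[1]` is the identity.) -/
abbrev PlanePerm (n : ℕ) : Type :=
  {p : Equiv.Perm (Fin n) × Equiv.Perm (Fin n) // p.1.IsCycleOn Set.univ}

namespace PlanePerm

variable {n : ℕ}

/-- The upper horizontal `s` of the plane permutation `(s, π)`. -/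
def upper (p : PlanePerm n) : Equiv.Perm (Fin n) := p.1.1

/-- The vertical `π` of the plane permutation `(s, π)`. -/
def vertical (p : PlanePerm n) : Equiv.Perm (Fin n) := p.1.2

/-- The diagonal of `(s, π)`: the permutation sending `π (s_{i-1})` to `s_i`,
that is, `s ∘ π⁻¹`. -/
def diagonal (p : PlanePerm n) : Equiv.Perm (Fin n) := p.upper * p.vertical⁻¹

end PlanePerm

/-- The set of plane permutations on `[n]` whose diagonal has cycle-type `lam` and whose vertical
has `k` cycles and fixes every element of `[m]` (in `Fin n`, the elements `0, …, m - 1`). -/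
def isolatedSet {n : ℕ} (lam : n.Partition) (m k : ℕ) : Set (PlanePerm n) :=
  {p | HasCycleType p.diagonal lam ∧ numCycles p.vertical = k ∧
    ∀ i : Fin n, i.val < m → p.vertical i = i}

/-- The number of elements of `isolatedSet lam m k`. -/
noncomputable def isolatedNumber {n : ℕ} (lam : n.Partition) (m k : ℕ) : ℕ :=
  (isolatedSet lam m k).ncard

/-- `mu` is obtained from `lam` by splitting one part `a` of `lam` into `r` parts
(the multiset `S`). -/
def SplitsInto {n : ℕ} (r : ℕ) (mu lam : n.Partition) : Prop :=
  ∃ a ∈ lam.parts, ∃ S : Multiset ℕ,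
    S.card = r ∧ S.sum = a ∧ mu.parts = lam.parts.erase a + S

noncomputable instance {n : ℕ} (r : ℕ) (lam : n.Partition) :
    DecidablePred fun mu : n.Partition => SplitsInto r mu lam :=
  fun _ => Classical.propDecidable _

/-- The number of ways of choosing `r` parts of `mu` whose merging into one part yields `lam`.
`Multiset.powersetCard` lists sub-multisets with multiplicity, so equal parts of `mu` are treated
as distinguishable. -/
def mergeCount {n : ℕ} (r : ℕ) (mu lam : n.Partition) : ℕ :=
  (mu.parts.powersetCard r).countP fun S => S.sum ::ₘ (mu.parts - S) = lam.parts

open Equiv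

section FullCycle

set_option linter.unusedSectionVars false

variable {X : Type*} [DecidableEq X] [Fintype X] {A : Finset X} {s g σ : Perm X} {r a b x y : X}

/-- `σ` fixes every point outside `A`. -/
def FixesOff (A : Finset X) (σ : Perm X) : Prop := ∀ x ∉ A, σ x = x

/-- `σ` is a cycle through all the points of `A`, and fixes the points outside `A`. -/
def FullCycle (A : Finset X) (σ : Perm X) : Prop :=
  FixesOff A σ ∧ ∀ x ∈ A, ∀ y ∈ A, σ.SameCycle x y

noncomputable instance (A : Finset X) (σ : Perm X) : Decidable (FixesOff A σ) :=
  Classical.propDecidable _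

noncomputable instance (A : Finset X) (σ : Perm X) : Decidable (FullCycle A σ) :=
  Classical.propDecidable _

/-- The position of `x` in the sequence `r, s r, s (s r), …`. -/
noncomputable def pos (s : Perm X) (r x : X) : ℕ := sInf {i : ℕ | (s ^ i) r = x}

theorem perm_apply_inv (σ : Perm X) (x : X) : σ (σ⁻¹ x) = x := σ.apply_symm_apply x

theorem perm_inv_apply (σ : Perm X) (x : X) : σ⁻¹ (σ x) = x := σ.symm_apply_apply x

theorem FixesOff.apply_mem (h : FixesOff A σ) : σ x ∈ A ↔ x ∈ A := by
  constructor
  · intro hx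
    by_contra hn
    rw [h x hn] at hx
    exact hn hx
  · intro hx
    by_contra hn
    have := σ.injective (h _ hn)
    rw [this] at hn
    exact hn hx

theorem FixesOff.inv (h : FixesOff A σ) : FixesOff A σ⁻¹ := by
  intro x hx
  rw [Perm.inv_eq_iff_eq, h x hx]

theorem FixesOff.mul {τ : Perm X} (h : FixesOff A σ) (h' : FixesOff A τ) : FixesOff A (σ * τ) := by
  intro x hx
  rw [Perm.mul_apply, h' x hx, h x hx]

theorem FixesOff.swap (ha : a ∈ A) (hb : b ∈ A) : FixesOff A (swap a b) := by
  intro x hx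
  exact swap_apply_of_ne_of_ne (fun h => hx (h ▸ ha)) (fun h => hx (h ▸ hb))

theorem FixesOff.mono {B : Finset X} (h : FixesOff A σ) (hAB : A ⊆ B) : FixesOff B σ :=
  fun x hx => h x fun h' => hx (hAB h')

theorem FixesOff.pow_mem (h : FixesOff A σ) (hx : x ∈ A) (i : ℕ) : (σ ^ i) x ∈ A := by
  induction i with
  | zero => simpa
  | succ i ih => rwa [pow_succ', Perm.mul_apply, h.apply_mem]

theorem exists_pow_of_sameCycle (h : σ.SameCycle x y) : ∃ i : ℕ, (σ ^ i) x = y := by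
  obtain ⟨i, hi⟩ := h.exists_nat_pow_eq
  exact ⟨i, hi⟩

theorem FixesOff.mem_of_sameCycle (h : FixesOff A σ) (hx : x ∈ A) (hxy : σ.SameCycle x y) :
    y ∈ A := by
  obtain ⟨i, rfl⟩ := exists_pow_of_sameCycle hxy
  exact h.pow_mem hx i

theorem sameCycle_of_forall {P : X → Prop} (hP : ∀ x, P x → P (σ x)) (hx : P x)
    (h : σ.SameCycle x y) : P y := by
  obtain ⟨i, rfl⟩ := exists_pow_of_sameCycle h
  induction i with
  | zero => simpa
  | succ i ih =>
    rw [pow_succ', Perm.mul_apply]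
    exact hP _ (ih ⟨i, by simp⟩)

namespace FullCycle

theorem pos_spec (h : FullCycle A s) (hr : r ∈ A) (hx : x ∈ A) : (s ^ pos s r x) r = x :=
  Nat.sInf_mem (s := {i : ℕ | (s ^ i) r = x}) (exists_pow_of_sameCycle (h.2 r hr x hx))

theorem pos_inj (h : FullCycle A s) (hr : r ∈ A) (hx : x ∈ A) (hy : y ∈ A)
    (hxy : pos s r x = pos s r y) : x = y := by
  rw [← h.pos_spec hr hx, hxy, h.pos_spec hr hy]

theorem _root_.pos_le {i : ℕ} (h : (s ^ i) r = x) : pos s r x ≤ i := Nat.sInf_le h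

theorem _root_.pos_self : pos s r r = 0 := Nat.le_zero.1 (pos_le (by simp))

theorem pos_apply (h : FullCycle A s) (hr : r ∈ A) (hx : x ∈ A) (hne : s x ≠ r) :
    pos s r (s x) = pos s r x + 1 := by
  apply le_antisymm
  · apply pos_le
    rw [pow_succ', Perm.mul_apply, h.pos_spec hr hx]
  · have hs := h.pos_spec hr ((h.1.apply_mem (x := x)).2 hx)
    cases hk : pos s r (s x) with
    | zero =>
      rw [hk] at hs
      exact absurd hs.symm (by simpa using hne)
    | succ j =>
      rw [hk, pow_succ', Perm.mul_apply] at hs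
      have := pos_le (s.injective hs)
      omega

theorem induct (h : FullCycle A s) (hr : r ∈ A) {P : X → Prop} (h0 : P r)
    (h1 : ∀ x ∈ A, s x ≠ r → P x → P (s x)) : ∀ x ∈ A, P x := by
  intro x hx
  have key : ∀ i : ℕ, P ((s ^ i) r) := by
    intro i
    induction i with
    | zero => simpa
    | succ i ih =>
      rw [pow_succ', Perm.mul_apply]
      by_cases hc : s ((s ^ i) r) = r
      · rwa [hc]
      · exact h1 _ (h.1.pow_mem hr i) hc ih
  rw [← h.pos_spec hr hx]
  exact key _

theorem pos_le_last (h : FullCycle A s) (hr : r ∈ A) (hp : s y = r) (hy : y ∈ A) (hx : x ∈ A) :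
    pos s r x ≤ pos s r y := by
  by_contra! hlt
  have h1 : (s ^ (pos s r y + 1)) r = r := by
    rw [pow_succ', Perm.mul_apply, h.pos_spec hr hy, hp]
  have h2 := h.pos_spec hr hx
  obtain ⟨d, hd⟩ := Nat.exists_eq_add_of_lt hlt
  have h3 : pos s r x = d + (pos s r y + 1) := by omega
  rw [h3, pow_add, Perm.mul_apply, h1] at h2
  have := pos_le h2
  omega

theorem lt_of_pos_lt (h : FullCycle A s) (hr : r ∈ A) {f : X → ℕ}
    (hf : ∀ x ∈ A, s x ≠ r → f x < f (s x)) (hx : x ∈ A) :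
    ∀ y ∈ A, pos s r x < pos s r y → f x < f y := by
  refine h.induct hr (P := fun y => pos s r x < pos s r y → f x < f y) ?_ ?_
  · simp [pos_self]
  · intro w hw hwr ih hlt
    rw [h.pos_apply hr hw hwr] at hlt
    rcases Nat.lt_succ_iff_lt_or_eq.1 hlt with h1 | h1
    · exact (ih h1).trans (hf w hw hwr)
    · rw [h.pos_inj hr hx hw h1]
      exact hf w hw hwr

/-- Any function increasing along `s`, except at the step into `r`, induces the same order as
the position. -/
theorem le_iff_pos_le (h : FullCycle A s) (hr : r ∈ A) {f : X → ℕ}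
    (hf : ∀ x ∈ A, s x ≠ r → f x < f (s x)) (hx : x ∈ A) (hy : y ∈ A) :
    f x ≤ f y ↔ pos s r x ≤ pos s r y := by
  rcases lt_trichotomy (pos s r x) (pos s r y) with h1 | h1 | h1
  · exact iff_of_true (h.lt_of_pos_lt hr hf hx y hy h1).le h1.le
  · rw [h.pos_inj hr hx hy h1]
    simp
  · exact iff_of_false (h.lt_of_pos_lt hr hf hy x hx h1).not_ge h1.not_ge

end FullCycle

theorem sameCycle_swap_mul (h : FullCycle A s) (ha : a ∈ A) (hb : b ∈ A) (hab : a ≠ b) :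
    ¬ (swap a b * s).SameCycle a b ∧
      ∀ x ∈ A, (pos s a x < pos s a b → (swap a b * s).SameCycle a x) ∧
        (pos s a b ≤ pos s a x → (swap a b * s).SameCycle b x) := by
  have hpos : 0 < pos s a b := by
    rcases Nat.eq_zero_or_pos (pos s a b) with h0 | h0
    · exact absurd (h.pos_inj ha ha hb (by rw [pos_self, h0])) hab
    · exact h0
  constructor
  · intro hs
    have := sameCycle_of_forall (P := fun x => x ∈ A ∧ pos s a x < pos s a b) ?_
      ⟨ha, by rwa [pos_self]⟩ hs
    · exact this.2.false
    rintro x ⟨hx, hlt⟩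
    rw [Perm.mul_apply]
    by_cases h1 : s x = b
    · rw [h1, swap_apply_right, pos_self]
      exact ⟨ha, hpos⟩
    · by_cases h2 : s x = a
      · exact absurd (h.pos_le_last ha h2 hx hb) hlt.not_ge
      · rw [swap_apply_of_ne_of_ne h2 h1, h.pos_apply ha hx h2]
        have hsx := h.1.apply_mem.2 hx
        refine ⟨hsx, lt_of_le_of_ne hlt fun heq => h1 ?_⟩
        exact h.pos_inj ha hsx hb (by rw [h.pos_apply ha hx h2, ← heq])
  · refine h.induct ha (P := fun x => (pos s a x < pos s a b → (swap a b * s).SameCycle a x) ∧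
      (pos s a b ≤ pos s a x → (swap a b * s).SameCycle b x)) ?_ ?_
    · rw [pos_self]
      exact ⟨fun _ => .refl _ _, fun h' => absurd h' hpos.not_ge⟩
    · intro x hx hxa ⟨ih1, ih2⟩
      by_cases h1 : s x = b
      · rw [h1]
        exact ⟨fun h' => absurd h' (lt_irrefl _), fun _ => .refl _ _⟩
      · have hg : (swap a b * s) x = s x := by
          rw [Perm.mul_apply, swap_apply_of_ne_of_ne hxa h1]
        have hne : pos s a (s x) ≠ pos s a b := fun heq =>
          h1 (h.pos_inj ha (h.1.apply_mem.2 hx) hb heq)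
        rw [h.pos_apply ha hx hxa] at hne ⊢
        rw [← hg, Perm.sameCycle_apply_right, Perm.sameCycle_apply_right]
        exact ⟨fun h' => ih1 (by omega), fun h' => ih2 (by omega)⟩

/-- In the cycle `s` opened at `a`, the points before `b` are those in the cycle of `a`
after the cycle is split at `a` and `b`. -/
theorem sameCycle_swap_mul_iff_pos_lt (h : FullCycle A s) (ha : a ∈ A) (hb : b ∈ A) (hab : a ≠ b)
    (hx : x ∈ A) : (swap a b * s).SameCycle a x ↔ pos s a x < pos s a b := by
  obtain ⟨h1, h2⟩ := sameCycle_swap_mul h ha hb hab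
  refine ⟨fun hs => ?_, (h2 x hx).1⟩
  by_contra! hle
  exact h1 (hs.trans ((h2 x hx).2 hle).symm)

theorem sameCycle_of_swap_mul (hnot : ¬ g.SameCycle a b) (hx : g.SameCycle a x) :
    (swap a b * g).SameCycle a x := by
  obtain ⟨i, rfl⟩ := exists_pow_of_sameCycle hx
  clear hx
  induction i with
  | zero => exact .refl _ _
  | succ i ih =>
    rw [pow_succ', Perm.mul_apply]
    by_cases h1 : g ((g ^ i) a) = a
    · rw [h1]
    · have h2 : g ((g ^ i) a) ≠ b := by
        intro h2
        apply hnot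
        rw [← h2, ← Perm.mul_apply, ← pow_succ']
        exact ⟨i + 1, by norm_cast⟩
      rw [← swap_apply_of_ne_of_ne h1 h2, ← Perm.mul_apply, Perm.sameCycle_apply_right]
      exact ih

/-- Multiplying by a transposition produces a full cycle exactly when it joins the two cycles of a
permutation having only two. -/
theorem fullCycle_swap_mul_iff (hg : FixesOff A g) (ha : a ∈ A) (hb : b ∈ A) (hab : a ≠ b) :
    FullCycle A (swap a b * g) ↔
      ¬ g.SameCycle a b ∧ ∀ x ∈ A, g.SameCycle a x ∨ g.SameCycle b x := by
  constructor
  · intro h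
    obtain ⟨h1, h2⟩ := sameCycle_swap_mul h ha hb hab
    rw [← mul_assoc, swap_mul_self, one_mul] at h1 h2
    refine ⟨h1, fun x hx => ?_⟩
    rcases lt_or_ge (pos (swap a b * g) a x) (pos (swap a b * g) a b) with h3 | h3
    · exact .inl ((h2 x hx).1 h3)
    · exact .inr ((h2 x hx).2 h3)
  · rintro ⟨h1, h2⟩
    have h3 : (swap a b * g).SameCycle a b := by
      have : (swap a b * g).SameCycle a (g⁻¹ a) :=
        sameCycle_of_swap_mul h1 ⟨-1, by simp⟩
      rw [← Perm.sameCycle_apply_right] at this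
      simpa using this
    have key : ∀ x ∈ A, (swap a b * g).SameCycle a x := by
      intro x hx
      rcases h2 x hx with h4 | h4
      · exact sameCycle_of_swap_mul h1 h4
      · refine h3.trans ?_
        rw [swap_comm]
        exact sameCycle_of_swap_mul (fun h => h1 h.symm) h4
    exact ⟨(FixesOff.swap ha hb).mul hg, fun x hx y hy => (key x hx).symm.trans (key y hy)⟩

theorem FullCycle.apply_ne (h : FullCycle A s) (hx : x ∈ A) (hy : y ∈ A) (hxy : x ≠ y) :
    s x ≠ x := by
  intro hf
  have := sameCycle_of_forall (P := fun z => z = x) (by rintro _ rfl; exact hf) rfl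
    (h.2 x hx y hy)
  exact hxy this.symm

/-- Inserting a fixed point next to a point of a full cycle. -/
theorem fullCycle_swap_mul_iff_erase (hg : FixesOff A g) (hb : b ∈ A) (ha : a ∈ A) (hab : a ≠ b)
    (hga : g a = a) : FullCycle A (swap a b * g) ↔ FullCycle (A.erase a) g := by
  have hfix : ∀ x, g.SameCycle a x → x = a := fun x hx =>
    sameCycle_of_forall (P := fun z => z = a) (by rintro _ rfl; exact hga) rfl hx
  rw [fullCycle_swap_mul_iff hg ha hb hab]
  constructor
  · rintro ⟨h1, h2⟩
    have key : ∀ x ∈ A.erase a, g.SameCycle b x := by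
      intro x hx
      rw [Finset.mem_erase] at hx
      rcases h2 x hx.2 with h | h
      · exact absurd (hfix x h) hx.1
      · exact h
    refine ⟨fun x hx => ?_, fun x hx y hy => (key x hx).symm.trans (key y hy)⟩
    by_cases hxa : x = a
    · rw [hxa, hga]
    · exact hg x fun h => hx (Finset.mem_erase.2 ⟨hxa, h⟩)
  · intro h
    refine ⟨fun h' => hab (hfix b h').symm, fun x hx => ?_⟩
    by_cases hxa : x = a
    · left; rw [hxa]
    · right
      exact h.2 b (Finset.mem_erase.2 ⟨hab.symm, hb⟩) x (Finset.mem_erase.2 ⟨hxa, hx⟩)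

theorem fullCycle_mul_swap_iff_erase (hg : FixesOff A g) (hb : b ∈ A) (ha : a ∈ A) (hab : a ≠ b)
    (hga : g a = a) : FullCycle A (g * swap b a) ↔ FullCycle (A.erase a) g := by
  have : g * swap b a = swap a (g b) * g := by
    rw [mul_swap_eq_swap_mul, hga, swap_comm]
  rw [this]
  refine fullCycle_swap_mul_iff_erase hg (hg.apply_mem.2 hb) ha (fun h => hab ?_) hga
  exact g.injective (hga.trans h)

end FullCycle

section Counting

set_option linter.unusedSectionVars false

variable {X : Type*} [DecidableEq X] [Fintype X] {A : Finset X} {s g σ Q R : Perm X}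
  {r a b p x y z : X}

theorem FixesOff.eq_one (h : FixesOff A σ) (hA : A.card ≤ 1) : σ = 1 := by
  ext x
  by_cases hx : x ∈ A
  · exact Finset.card_le_one.1 hA _ (h.apply_mem.2 hx) _ hx
  · exact h x hx

theorem fullCycle_iff_of_card_eq_one (hA : A.card = 1) : FullCycle A σ ↔ σ = 1 := by
  refine ⟨fun h => h.1.eq_one hA.le, ?_⟩
  rintro rfl
  refine ⟨fun x _ => rfl, fun x hx y hy => ?_⟩
  rw [Finset.card_le_one.1 hA.le x hx y hy]

theorem FixesOff.erase (h : FixesOff A g) (ha : g a = a) : FixesOff (A.erase a) g := by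
  intro x hx
  by_cases hxa : x = a
  · rw [hxa, ha]
  · exact h x fun h' => hx (Finset.mem_erase.2 ⟨hxa, h'⟩)

theorem sum_fullCycle_insert {M : Type*} [AddCommMonoid M] (hy : y ∈ A)
    (hA : (A.erase y).Nonempty) (F : Perm X → M) :
    ∑ σ with FullCycle A σ, F σ =
      ∑ τ with FullCycle (A.erase y) τ, ∑ p ∈ A.erase y, F (τ * swap p y) := by
  obtain ⟨w, hw⟩ := hA
  rw [Finset.mem_erase] at hw
  rw [← Finset.sum_product']
  refine Finset.sum_bij' (fun σ _ => (σ * swap (σ⁻¹ y) y, σ⁻¹ y)) (fun q _ => q.1 * swap q.2 y)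
    ?_ ?_ ?_ ?_ ?_
  · intro σ hσ
    simp only [Finset.mem_filter, Finset.mem_univ, true_and] at hσ
    have hp : σ⁻¹ y ∈ A := hσ.1.inv.apply_mem.2 hy
    have hne : σ⁻¹ y ≠ y := by
      intro h
      rw [Perm.inv_eq_iff_eq] at h
      exact hσ.apply_ne hy hw.2 hw.1.symm h.symm
    simp only [Finset.mem_product, Finset.mem_filter, Finset.mem_univ, true_and,
      Finset.mem_erase]
    refine ⟨?_, hne, hp⟩
    rw [← fullCycle_mul_swap_iff_erase (hσ.1.mul (.swap hp hy)) hp hy hne.symm (by simp)]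
    rwa [mul_assoc, swap_mul_self, mul_one]
  · rintro ⟨τ, p⟩ hq
    simp only [Finset.mem_product, Finset.mem_filter, Finset.mem_univ, true_and,
      Finset.mem_erase] at hq ⊢
    have hτ := hq.1
    exact (fullCycle_mul_swap_iff_erase (hτ.1.mono (Finset.erase_subset _ _)) hq.2.2 hy
      hq.2.1.symm (hτ.1 y (by simp))).2 hτ
  · intro σ _
    simp [mul_assoc]
  · rintro ⟨τ, p⟩ hq
    simp only [Finset.mem_product, Finset.mem_filter, Finset.mem_univ, true_and,
      Finset.mem_erase] at hq
    have : (τ * swap p y)⁻¹ y = p := by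
      rw [Perm.inv_eq_iff_eq, Perm.mul_apply, swap_apply_left, hq.1.1 y (by simp)]
    simp only [this, mul_assoc, swap_mul_self, mul_one]
  · intro σ _
    simp [mul_assoc]

theorem sum_fullCycle_insert_left {M : Type*} [AddCommMonoid M] (hz : z ∈ A)
    (hA : (A.erase z).Nonempty) (F : Perm X → M) :
    ∑ σ with FullCycle A σ, F σ =
      ∑ x ∈ A.erase z, ∑ τ with FullCycle (A.erase x) τ, F (swap x z * τ) := by
  obtain ⟨w, hw⟩ := hA
  rw [Finset.mem_erase] at hw
  rw [Finset.sum_sigma']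
  refine Finset.sum_bij' (fun σ _ => ⟨σ⁻¹ z, swap (σ⁻¹ z) z * σ⟩) (fun q _ => swap q.1 z * q.2)
    ?_ ?_ ?_ ?_ ?_
  · intro σ hσ
    simp only [Finset.mem_filter, Finset.mem_univ, true_and] at hσ
    have hp : σ⁻¹ z ∈ A := hσ.1.inv.apply_mem.2 hz
    have hne : σ⁻¹ z ≠ z := by
      intro h
      rw [Perm.inv_eq_iff_eq] at h
      exact hσ.apply_ne hz hw.2 hw.1.symm h.symm
    simp only [Finset.mem_sigma, Finset.mem_filter, Finset.mem_univ, true_and,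
      Finset.mem_erase]
    refine ⟨⟨hne, hp⟩, ?_⟩
    rw [← fullCycle_swap_mul_iff_erase ((FixesOff.swap hp hz).mul hσ.1) hz hp hne (by simp)]
    rwa [← mul_assoc, swap_mul_self, one_mul]
  · rintro ⟨x, τ⟩ hq
    simp only [Finset.mem_sigma, Finset.mem_filter, Finset.mem_univ, true_and,
      Finset.mem_erase] at hq ⊢
    have hτ := hq.2
    exact (fullCycle_swap_mul_iff_erase (hτ.1.mono (Finset.erase_subset _ _)) hz hq.1.2
      hq.1.1 (hτ.1 x (by simp))).2 hτ
  · intro σ _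
    simp [← mul_assoc]
  · rintro ⟨x, τ⟩ hq
    simp only [Finset.mem_sigma, Finset.mem_filter, Finset.mem_univ, true_and,
      Finset.mem_erase] at hq
    have : (swap x z * τ)⁻¹ z = x := by
      rw [Perm.inv_eq_iff_eq, Perm.mul_apply, hq.2.1 x (by simp), swap_apply_left]
    simp only [this, ← mul_assoc, swap_mul_self, one_mul]
  · intro σ _
    simp [← mul_assoc]

theorem card_fullCycle (hA : A.Nonempty) :
    (Finset.univ.filter fun σ : Perm X => FullCycle A σ).card = (A.card - 1).factorial := by
  induction hn : A.card generalizing A with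
  | zero => exact absurd (Finset.card_eq_zero.1 hn) hA.ne_empty
  | succ n ih =>
    rcases Nat.eq_zero_or_pos n with rfl | hpos
    · have : (Finset.univ.filter fun σ : Perm X => FullCycle A σ) = {1} := by
        ext σ
        simp [fullCycle_iff_of_card_eq_one hn]
      simp [this]
    · obtain ⟨y, hy⟩ := hA
      have hc : (A.erase y).card = n := by rw [Finset.card_erase_of_mem hy, hn]; rfl
      have hne : (A.erase y).Nonempty := Finset.card_pos.1 (by omega)
      rw [Finset.card_eq_sum_ones, sum_fullCycle_insert hy hne]
      simp only [Finset.sum_const, smul_eq_mul, mul_one, hc, ih hne hc]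
      obtain ⟨k, rfl⟩ : ∃ k, n = k + 1 := ⟨n - 1, by omega⟩
      simp [Nat.factorial_succ, mul_comm]

/-- With `g` fixing `y`, inserting `y` after `p` and then joining `y` to `z` gives a full cycle
exactly when `g` becomes a full cycle on the other points after joining `g p` to `z`. -/
theorem fullCycle_swap_mul_mul_swap_iff (hg : FixesOff A g) (hy : y ∈ A) (hgy : g y = y)
    (hz : z ∈ A.erase y) (hp : p ∈ A.erase y) :
    FullCycle A (swap y z * (g * swap p y)) ↔
      g p ≠ z ∧ FullCycle (A.erase y) (swap (g p) z * g) := by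
  have hg' := hg.erase hgy
  have hq : g p ∈ A.erase y := hg'.apply_mem.2 hp
  rw [Finset.mem_erase] at hz hq hp
  have h1 : g * swap p y = swap y (g p) * g := by
    rw [mul_swap_eq_swap_mul, hgy, swap_comm]
  rw [h1, ← mul_assoc]
  by_cases hpz : g p = z
  · rw [hpz, swap_mul_self, one_mul]
    refine iff_of_false (fun h => ?_) (by simp)
    exact h.apply_ne hy hz.2 hz.1.symm hgy
  · have h2 : swap y z * swap y (g p) = swap y (g p) * swap (g p) z := by
      rw [mul_swap_eq_swap_mul (swap y (g p)) (g p) z, swap_apply_right,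
        swap_apply_of_ne_of_ne hz.1 (Ne.symm hpz)]
    rw [h2, mul_assoc, fullCycle_swap_mul_iff_erase ((FixesOff.swap hq.2 hz.2).mul hg) hq.2 hy
      hq.1.symm]
    · simp [hpz]
    · rw [Perm.mul_apply, hgy, swap_apply_of_ne_of_ne hq.1.symm hz.1.symm]

theorem exists_apply_ne_of_sign (hQ : Perm.sign Q = -1) : ∃ y, Q y ≠ y := by
  by_contra! h
  have : Q = 1 := Perm.ext h
  simp [this] at hQ

theorem FixesOff.sum_comp {M : Type*} [AddCommMonoid M] (hg : FixesOff A g) (F : X → M) :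
    ∑ p ∈ A, F (g p) = ∑ q ∈ A, F q :=
  Finset.sum_bij' (fun p _ => g p) (fun q _ => g⁻¹ q) (fun _ h => hg.apply_mem.2 h)
    (fun _ h => hg.inv.apply_mem.2 h) (by simp) (by simp) (by simp)

/-- Every odd permutation of `A` is, in `2 (|A| - 2)!` ways, a product of a full cycle and the
inverse of a cycle missing exactly one point. -/
theorem sum_fullCycle_erase_mul (hQ : FixesOff A Q) (hs : Perm.sign Q = -1) :
    ∑ x ∈ A, ∑ σ with FullCycle (A.erase x) σ, (if FullCycle A (Q * σ) then 1 else 0) =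
      2 * (A.card - 2).factorial := by
  induction hn : A.card using Nat.strong_induction_on generalizing A Q with
  | _ n ih =>
  subst hn
  obtain ⟨y, hyz⟩ := exists_apply_ne_of_sign hs
  have hy : y ∈ A := by
    by_contra h
    exact hyz (hQ y h)
  set z := Q y with hzdef
  have hz : z ∈ A := hQ.apply_mem.2 hy
  set Q' := swap y z * Q with hQ'def
  have hQQ' : Q = swap y z * Q' := by rw [hQ'def, ← mul_assoc, swap_mul_self, one_mul]
  have hQ'y : Q' y = y := by rw [hQ'def, Perm.mul_apply, ← hzdef, swap_apply_right]
  have hQ'A : FixesOff A Q' := (FixesOff.swap hy hz).mul hQ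
  have hQ'A' : FixesOff (A.erase y) Q' := hQ'A.erase hQ'y
  have hs' : Perm.sign Q' = 1 := by
    rw [hQ'def, Perm.sign_mul, Perm.sign_swap (Ne.symm hyz), hs]; rfl
  clear_value Q'
  have hzA' : z ∈ A.erase y := Finset.mem_erase.2 ⟨hyz, hz⟩
  have hcard : (A.erase y).card = A.card - 1 := Finset.card_erase_of_mem hy
  have h2 : 2 ≤ A.card := by
    have := Finset.card_pos.2 ⟨z, hzA'⟩
    omega
  rcases h2.eq_or_lt with h2 | h3
  · have hone : ∀ x ∈ A, ∀ σ, FullCycle (A.erase x) σ ↔ σ = 1 := fun x hx σ =>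
      fullCycle_iff_of_card_eq_one (by rw [Finset.card_erase_of_mem hx]; omega)
    have hfull : FullCycle A Q := by
      have hA : A = {y, z} := by
        symm
        apply Finset.eq_of_subset_of_card_le
        · intro w hw
          simp only [Finset.mem_insert, Finset.mem_singleton] at hw
          rcases hw with rfl | rfl <;> assumption
        · rw [Finset.card_pair (Ne.symm hyz)]; omega
      have key : ∀ w ∈ A, Q.SameCycle y w := by
        intro w hw
        rw [hA] at hw
        simp only [Finset.mem_insert, Finset.mem_singleton] at hw
        rcases hw with rfl | rfl
        · exact .refl _ _
        · rw [hzdef, Perm.sameCycle_apply_right]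
      exact ⟨hQ, fun u hu v hv => (key u hu).symm.trans (key v hv)⟩
    have : ∀ x ∈ A, ∑ σ with FullCycle (A.erase x) σ,
        (if FullCycle A (Q * σ) then 1 else 0) = 1 := by
      intro x hx
      have h1 : (Finset.univ.filter fun σ : Perm X => FullCycle (A.erase x) σ) = {1} := by
        ext σ
        simp [hone x hx]
      rw [h1, Finset.sum_singleton, mul_one, if_pos hfull]
    rw [Finset.sum_congr rfl this]
    simp [← h2]
  · have hne' : ((A.erase y).erase z).Nonempty := by
      apply Finset.card_pos.1
      rw [Finset.card_erase_of_mem hzA', hcard]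
      omega
    rw [← Finset.add_sum_erase _ _ hy]
    have hfirst : ∑ σ with FullCycle (A.erase y) σ, (if FullCycle A (Q * σ) then 1 else 0) =
        ∑ σ with FullCycle (A.erase y) σ,
          (if FullCycle (A.erase y) (Q' * σ) then 1 else 0) := by
      refine Finset.sum_congr rfl fun σ hσ => ?_
      simp only [Finset.mem_filter, Finset.mem_univ, true_and] at hσ
      have hσy : σ y = y := hσ.1 y (by simp)
      have e := fullCycle_swap_mul_iff_erase
        (hQ'A.mul (hσ.1.mono (Finset.erase_subset _ _))) hz hy (Ne.symm hyz)
        (by rw [Perm.mul_apply, hσy, hQ'y])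
      simp only [hQQ', mul_assoc, e]
    set H : X → Perm X → X → ℕ := fun x τ p => if (Q' * τ) p ≠ z ∧
      FullCycle (A.erase y) (swap ((Q' * τ) p) z * (Q' * τ)) then 1 else 0 with hH
    have hsecond : ∑ x ∈ A.erase y, ∑ σ with FullCycle (A.erase x) σ,
          (if FullCycle A (Q * σ) then 1 else 0) =
        ∑ x ∈ A.erase y, ∑ τ with FullCycle ((A.erase y).erase x) τ,
          ∑ p ∈ (A.erase y).erase x, H x τ p := by
      refine Finset.sum_congr rfl fun x hx => ?_
      have hx' := Finset.mem_erase.1 hx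
      have hyx : y ∈ A.erase x := Finset.mem_erase.2 ⟨hx'.1.symm, hy⟩
      have hne : ((A.erase x).erase y).Nonempty := by
        apply Finset.card_pos.1
        rw [Finset.card_erase_of_mem hyx, Finset.card_erase_of_mem hx'.2]
        omega
      rw [sum_fullCycle_insert hyx hne, Finset.erase_right_comm]
      refine Finset.sum_congr rfl fun τ hτ => Finset.sum_congr rfl fun p hp => ?_
      simp only [Finset.mem_filter, Finset.mem_univ, true_and] at hτ
      have hτ' : FixesOff (A.erase y) τ := hτ.1.mono (Finset.erase_subset _ _)
      have hτy : τ y = y := hτ' y (by simp)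
      have e : Q * (τ * swap p y) = swap y z * ((Q' * τ) * swap p y) := by
        rw [hQQ']; simp only [mul_assoc]
      rw [e, hH]
      simp only [fullCycle_swap_mul_mul_swap_iff
        (hQ'A.mul (hτ'.mono (Finset.erase_subset _ _))) hy (by rw [Perm.mul_apply, hτy, hQ'y])
        hzA' (Finset.mem_of_mem_erase hp)]
    have htotal : ∑ x ∈ A.erase y, ∑ τ with FullCycle ((A.erase y).erase x) τ,
          ∑ p ∈ A.erase y, H x τ p = (A.card - 2) * (2 * (A.card - 3).factorial) := by
      have h1 : ∀ x ∈ A.erase y, ∑ τ with FullCycle ((A.erase y).erase x) τ,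
          ∑ p ∈ A.erase y, H x τ p = ∑ q ∈ (A.erase y).erase z,
            ∑ τ with FullCycle ((A.erase y).erase x) τ,
              (if FullCycle (A.erase y) (swap q z * Q' * τ) then 1 else 0) := by
        intro x hx
        rw [Finset.sum_comm]
        rw [Finset.sum_comm, Finset.sum_comm (s := (A.erase y).erase z)]
        refine Finset.sum_congr rfl fun τ hτ => ?_
        simp only [Finset.mem_filter, Finset.mem_univ, true_and] at hτ
        have hτ' : FixesOff (A.erase y) τ := hτ.1.mono (Finset.erase_subset _ _)
        rw [hH, (hQ'A'.mul hτ').sum_comp (fun q => if q ≠ z ∧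
          FullCycle (A.erase y) (swap q z * (Q' * τ)) then 1 else 0)]
        rw [← Finset.add_sum_erase _ _ hzA']
        simp only [ne_eq, not_true_eq_false, false_and, if_false, zero_add]
        refine Finset.sum_congr rfl fun q hq => ?_
        simp only [Finset.ne_of_mem_erase hq, not_false_eq_true, true_and, mul_assoc]
      rw [Finset.sum_congr rfl h1, Finset.sum_comm]
      rw [Finset.sum_congr rfl (g := fun _ => 2 * (A.card - 3).factorial)]
      · rw [Finset.sum_const, Finset.card_erase_of_mem hzA', hcard, smul_eq_mul]
        rfl
      · intro q hq
        have hq' := Finset.mem_erase.1 hq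
        rw [ih (A.erase y).card (by omega) ((FixesOff.swap hq'.2 hzA').mul hQ'A') (by
          rw [Perm.sign_mul, Perm.sign_swap hq'.1, hs']; rfl) rfl, hcard]
        rfl
    have hdiag : ∑ x ∈ A.erase y, ∑ τ with FullCycle ((A.erase y).erase x) τ, H x τ x =
        ∑ σ with FullCycle (A.erase y) σ,
          (if FullCycle (A.erase y) (Q' * σ) then 1 else 0) := by
      have hz' : Q'⁻¹ z ∈ A.erase y := hQ'A'.inv.apply_mem.2 hzA'
      have hne : ((A.erase y).erase (Q'⁻¹ z)).Nonempty := by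
        apply Finset.card_pos.1
        rw [Finset.card_erase_of_mem hz', hcard]
        omega
      rw [sum_fullCycle_insert_left hz' hne, ← Finset.add_sum_erase _ _ hz']
      have hx0 : ∀ x, ∀ τ ∈ Finset.univ.filter
          (fun τ : Perm X => FullCycle ((A.erase y).erase x) τ), H x τ x =
          if Q' x ≠ z ∧ FullCycle (A.erase y) (Q' * (swap x (Q'⁻¹ z) * τ)) then 1 else 0 := by
        intro x τ hτ
        simp only [Finset.mem_filter, Finset.mem_univ, true_and] at hτ
        have hτx : (Q' * τ) x = Q' x := by rw [Perm.mul_apply, hτ.1 x (by simp)]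
        have e : swap (Q' x) z * (Q' * τ) = Q' * (swap x (Q'⁻¹ z) * τ) := by
          rw [← mul_assoc, ← mul_assoc, mul_swap_eq_swap_mul, perm_apply_inv]
        simp only [hH, hτx, e]
      rw [Finset.sum_congr rfl (hx0 _)]
      simp only [perm_apply_inv, ne_eq, not_true_eq_false, false_and, if_false,
        Finset.sum_const_zero, zero_add]
      refine Finset.sum_congr rfl fun x hx => ?_
      rw [Finset.sum_congr rfl (hx0 x)]
      refine Finset.sum_congr rfl fun τ hτ => ?_
      have : Q' x ≠ z := fun h => Finset.ne_of_mem_erase hx (by rw [← h, perm_inv_apply])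
      simp [this]
    have hsplit : ∑ x ∈ A.erase y, ∑ τ with FullCycle ((A.erase y).erase x) τ,
          ∑ p ∈ A.erase y, H x τ p =
        ∑ x ∈ A.erase y, ∑ τ with FullCycle ((A.erase y).erase x) τ, H x τ x +
        ∑ x ∈ A.erase y, ∑ τ with FullCycle ((A.erase y).erase x) τ,
          ∑ p ∈ (A.erase y).erase x, H x τ p := by
      rw [← Finset.sum_add_distrib]
      refine Finset.sum_congr rfl fun x hx => ?_
      rw [← Finset.sum_add_distrib]
      refine Finset.sum_congr rfl fun τ _ => ?_
      rw [Finset.add_sum_erase _ _ hx]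
    rw [hfirst, hsecond, ← hdiag, ← hsplit, htotal]
    obtain ⟨k, hk⟩ : ∃ k, A.card = k + 3 := ⟨A.card - 3, by omega⟩
    rw [hk]
    simp only [Nat.reduceSubDiff, Nat.add_sub_cancel, Nat.factorial_succ]
    ring

theorem sum_fullCycle_mul_swap_apply (hQ : FixesOff A Q) (hs : Perm.sign Q = -1) :
    ∑ σ with FullCycle A σ, ∑ x ∈ A, (if FullCycle A (Q * σ * swap x (σ x)) then 1 else 0) =
      2 * (A.card - 1).factorial := by
  have h2 : 2 ≤ A.card := by
    by_contra! h
    rw [hQ.eq_one (by omega)] at hs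
    simp at hs
  have h1 : ∀ σ ∈ Finset.univ.filter (fun σ : Perm X => FullCycle A σ),
      ∑ x ∈ A, (if FullCycle A (Q * σ * swap x (σ x)) then 1 else 0) =
      ∑ y ∈ A, (if FullCycle A (Q * (σ * swap (σ⁻¹ y) y)) then 1 else 0) := by
    intro σ hσ
    simp only [Finset.mem_filter, Finset.mem_univ, true_and] at hσ
    rw [← hσ.1.sum_comp (fun y => if FullCycle A (Q * (σ * swap (σ⁻¹ y) y)) then 1 else 0)]
    simp [mul_assoc]
  rw [Finset.sum_congr rfl h1, Finset.sum_comm]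
  have h3 : ∀ y ∈ A, ∑ σ with FullCycle A σ,
      (if FullCycle A (Q * (σ * swap (σ⁻¹ y) y)) then 1 else 0) =
      (A.card - 1) * ∑ τ with FullCycle (A.erase y) τ,
        (if FullCycle A (Q * τ) then 1 else 0) := by
    intro y hy
    have hc := Finset.card_erase_of_mem hy
    rw [sum_fullCycle_insert hy (Finset.card_pos.1 (by omega)), Finset.mul_sum]
    refine Finset.sum_congr rfl fun τ hτ => ?_
    simp only [Finset.mem_filter, Finset.mem_univ, true_and] at hτ
    rw [← hc, ← smul_eq_mul, ← Finset.sum_const]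
    refine Finset.sum_congr rfl fun p hp => ?_
    have : (τ * swap p y)⁻¹ y = p := by
      rw [Perm.inv_eq_iff_eq, Perm.mul_apply, swap_apply_left, hτ.1 y (by simp)]
    rw [this, mul_assoc τ, swap_mul_self, mul_one]
  rw [Finset.sum_congr rfl h3, ← Finset.mul_sum, sum_fullCycle_erase_mul hQ hs]
  obtain ⟨k, hk⟩ : ∃ k, A.card = k + 2 := ⟨A.card - 2, by omega⟩
  rw [hk]
  simp only [Nat.add_sub_cancel, show k + 2 - 1 = k + 1 from rfl, Nat.factorial_succ]
  ring

end Counting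

section AntiExceedances

set_option linter.unusedSectionVars false

variable {X : Type*} [DecidableEq X] [Fintype X] {A B : Finset X} {s g σ τ Q R : Perm X}
  {r a b p x y z : X}

/-- The number of points of `B` that `σ` does not move forward in the sequence
`r, s r, s (s r), …`. -/
noncomputable def antiExc (s : Perm X) (r : X) (σ : Perm X) (B : Finset X) : ℕ :=
  (B.filter fun x => pos s r (σ x) ≤ pos s r x).card

theorem antiExc_apply_root (h : FullCycle A s) (hσ : FixesOff A σ) (hr : r ∈ A) :
    antiExc s (s r) σ A = antiExc s r σ A := by
  have hsr : s r ∈ A := h.1.apply_mem.2 hr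
  by_cases hs1 : s r = r
  · rw [hs1]
  set f : X → ℕ := fun x => if x = r then A.sup (pos s r) + 1 else pos s r x with hf
  have hbound : ∀ x ∈ A, pos s r x < f r := by
    intro x hx
    simp only [hf, if_true]
    exact Nat.lt_succ_of_le (Finset.le_sup hx)
  have hne : ∀ x, x ≠ r → f x = pos s r x := fun x hx => by simp [hf, hx]
  have hfs : ∀ x ∈ A, s x ≠ s r → f x < f (s x) := by
    intro x hx hxr
    have hxr' : x ≠ r := fun h => hxr (h ▸ rfl)
    rw [hne x hxr']
    by_cases h1 : s x = r
    · rw [h1]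
      exact hbound x hx
    · rw [hne _ h1, h.pos_apply hr hx h1]
      omega
  have hleft : antiExc s (s r) σ A = (A.filter fun x => f (σ x) ≤ f x).card := by
    rw [antiExc]
    congr 1
    refine Finset.filter_congr fun x hx => ?_
    rw [h.le_iff_pos_le hsr hfs (hσ.apply_mem.2 hx) hx]
  rw [hleft, antiExc]
  by_cases hfix : σ r = r
  · congr 1
    refine Finset.filter_congr fun x hx => ?_
    by_cases hxr : x = r
    · rw [hxr, hfix]
      simp
    · rw [hne x hxr, hne]
      intro h'
      exact hxr (σ.injective (h'.trans hfix.symm))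
  · have hpr : σ⁻¹ r ≠ r := by
      intro h'
      rw [Perm.inv_eq_iff_eq] at h'
      exact hfix h'.symm
    have hσp : σ (σ⁻¹ r) = r := perm_apply_inv _ _
    have h1 : r ∈ A.filter fun x => f (σ x) ≤ f x := by
      rw [Finset.mem_filter, hne _ hfix]
      exact ⟨hr, (hbound _ (hσ.apply_mem.2 hr)).le⟩
    have h2 : σ⁻¹ r ∈ A.filter fun x => pos s r (σ x) ≤ pos s r x := by
      rw [Finset.mem_filter, hσp, pos_self]
      exact ⟨hσ.inv.apply_mem.2 hr, Nat.zero_le _⟩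
    rw [← Finset.card_erase_add_one h1, ← Finset.card_erase_add_one h2]
    congr 2
    ext x
    simp only [Finset.mem_erase, Finset.mem_filter]
    by_cases hxr : x = r
    · simp only [hxr, ne_eq, not_true_eq_false, false_and, false_iff, not_and, not_le]
      intro _ _
      rw [pos_self]
      by_contra! h0
      exact hfix (h.pos_inj hr (hσ.apply_mem.2 hr) hr (by rw [pos_self]; omega))
    · by_cases hxp : x = σ⁻¹ r
      · simp only [hxp, ne_eq, not_true_eq_false, false_and, iff_false, not_and, not_le]
        intro _ hA
        rw [hσp, hne _ hpr]
        exact hbound _ hA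
      · have : σ x ≠ r := fun h' => hxp (by rw [← h', perm_inv_apply])
        rw [hne x hxr, hne _ this]
        simp only [ne_eq, hxr, hxp, not_false_eq_true, true_and]

/-- The number of anti-exceedances does not depend on where the cycle is opened. -/
theorem antiExc_root (h : FullCycle A s) (hσ : FixesOff A σ) (hr : r ∈ A) (hx : x ∈ A) :
    antiExc s x σ A = antiExc s r σ A :=
  h.induct hr (P := fun x => antiExc s x σ A = antiExc s r σ A) rfl
    (fun _ hw _ ih => (antiExc_apply_root h hσ hw).trans ih) x hx

theorem antiExc_self (h : FullCycle A s) (hr : r ∈ A) : antiExc s r s A = 1 := by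
  rw [antiExc, Finset.card_eq_one]
  refine ⟨s⁻¹ r, ?_⟩
  ext x
  simp only [Finset.mem_filter, Finset.mem_singleton]
  constructor
  · rintro ⟨hx, hle⟩
    by_contra hne
    rw [h.pos_apply hr hx fun h' => hne (by rw [← h', perm_inv_apply])] at hle
    omega
  · rintro rfl
    rw [perm_apply_inv, pos_self]
    exact ⟨h.1.inv.apply_mem.2 hr, Nat.zero_le _⟩

/-- How the number of anti-exceedances changes when the point `y` is inserted. -/
theorem antiExc_insert (hg : FixesOff A g) (hy : y ∈ A) (hgy : g y = y)
    (hτ : FixesOff (A.erase y) τ) (hz : z ∈ A.erase y) (hp : p ∈ A.erase y) (hpz : g p ≠ z)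
    (h : FullCycle (A.erase y) (swap (g p) z * g)) :
    antiExc (swap y z * (g * swap p y)) z (τ * swap p y) A =
      antiExc (swap (g p) z * g) z τ (A.erase y) + if g.SameCycle z (τ p) then 1 else 0 := by
  have hs : FullCycle A (swap y z * (g * swap p y)) :=
    (fullCycle_swap_mul_mul_swap_iff hg hy hgy hz hp).2 ⟨hpz, h⟩
  set s := swap y z * (g * swap p y) with hsdef
  set s' := swap (g p) z * g with hsdef'
  have hq : g p ∈ A.erase y := (hg.erase hgy).apply_mem.2 hp
  obtain ⟨hzy, hzA⟩ := Finset.mem_erase.1 hz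
  obtain ⟨hpy, hpA⟩ := Finset.mem_erase.1 hp
  obtain ⟨hqy, hqA⟩ := Finset.mem_erase.1 hq
  have hsp : s p = z := by simp [hsdef, hgy]
  have hsy : s y = g p := by simp [hsdef, swap_apply_of_ne_of_ne hqy hpz]
  have hs'p : s' p = z := by simp [hsdef']
  have hgz : g (g⁻¹ z) = z := perm_apply_inv _ _
  have hf : ∀ x ∈ A.erase y, s' x ≠ z → pos s z x < pos s z (s' x) := by
    intro x hx hxz
    obtain ⟨hxy, hxA⟩ := Finset.mem_erase.1 hx
    have hxp : x ≠ p := fun h' => hxz (h' ▸ hs'p)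
    have e1 : s x = swap y z (g x) := by
      simp [hsdef, swap_apply_of_ne_of_ne hxp hxy]
    have e2 : s' x = swap (g p) z (g x) := rfl
    by_cases h1 : g x = z
    · rw [h1, swap_apply_right] at e1 e2
      rw [e2, ← hsy, hs.pos_apply hzA hy (by rwa [hsy]), ← e1,
        hs.pos_apply hzA hxA (by rw [e1]; exact hzy.symm)]
      omega
    · have h2 : g x ≠ g p := fun h' => hxp (g.injective h')
      have h3 : g x ≠ y := fun h' => hxy (g.injective (h'.trans hgy.symm))
      rw [swap_apply_of_ne_of_ne h3 h1] at e1
      rw [swap_apply_of_ne_of_ne h2 h1] at e2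
      rw [e2, ← e1, hs.pos_apply hzA hxA (by rwa [e1])]
      omega
  have hle : ∀ x ∈ A.erase y, ∀ w ∈ A.erase y, (pos s z x ≤ pos s z w ↔ pos s' z x ≤ pos s' z w) :=
    fun x hx w hw => h.le_iff_pos_le hz hf hx hw
  have hτp : τ p ∈ A.erase y := hτ.apply_mem.2 hp
  have hτy : τ y = y := hτ y (by simp)
  rw [antiExc, antiExc, Finset.card_filter, Finset.card_filter, ← Finset.add_sum_erase _ _ hy,
    add_comm]
  congr 1
  · refine Finset.sum_congr rfl fun x hx => ?_
    by_cases hxp : x = p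
    · rw [hxp, Perm.mul_apply, swap_apply_left, hτy, if_pos (hs.pos_le_last hzA hsp hpA hy),
        if_pos (h.pos_le_last hz hs'p hp hτp)]
    · rw [Perm.mul_apply, swap_apply_of_ne_of_ne hxp (Finset.ne_of_mem_erase hx)]
      simp only [hle _ (hτ.apply_mem.2 hx) _ hx]
  · rw [Perm.mul_apply, swap_apply_right]
    have key : g.SameCycle z (τ p) ↔ pos s z (τ p) ≤ pos s z y := by
      have e := sameCycle_swap_mul_iff_pos_lt h hz hq hpz.symm hτp
      rw [hsdef', ← mul_assoc, swap_comm z, swap_mul_self, one_mul, ← hsdef'] at e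
      rw [e, ← not_le, ← hle _ hq _ hτp, not_le, ← hsy, hs.pos_apply hzA hy (by rwa [hsy]),
        Nat.lt_succ_iff]
    simp only [key]

/-- Summing over the points entering the cycle of `z` counts half of the points moved from one
cycle to another. -/
theorem two_mul_sum_sameCycle_apply (hg : FixesOff A g) (hτ : FullCycle A τ) (hz : z ∈ A)
    (hA : 2 ≤ A.card) :
    2 * ∑ p ∈ A, (if (g p ≠ z ∧ FullCycle A (swap (g p) z * g)) ∧ g.SameCycle z (τ p)
        then 1 else 0) =
      ∑ p ∈ A, (if FullCycle A (g * swap p (τ p)) then 1 else 0) := by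
  classical
  obtain ⟨C, hC⟩ : ∃ C : Prop, C ↔ ∀ u ∈ A, ∀ v ∈ A, ¬ g.SameCycle z u → ¬ g.SameCycle z v →
    g.SameCycle u v := ⟨_, Iff.rfl⟩
  have h1 : ∀ p ∈ A, (g p ≠ z ∧ FullCycle A (swap (g p) z * g)) ↔ ¬ g.SameCycle z p ∧ C := by
    intro p hp
    have e : g p ≠ z → (FullCycle A (swap (g p) z * g) ↔ _) := fun hne =>
      fullCycle_swap_mul_iff hg (hg.apply_mem.2 hp) hz hne
    simp only [Perm.sameCycle_apply_left] at e
    constructor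
    · rintro ⟨hne, hf⟩
      obtain ⟨h2, h3⟩ := (e hne).1 hf
      refine ⟨fun h => h2 h.symm, hC.2 fun u hu v hv hzu hzv => ?_⟩
      exact ((h3 u hu).resolve_right hzu).symm.trans ((h3 v hv).resolve_right hzv)
    · rintro ⟨h2, h3⟩
      have hne : g p ≠ z := fun h => h2 ⟨-1, by simp [← h]⟩
      refine ⟨hne, (e hne).2 ⟨fun h => h2 h.symm, fun x hx => ?_⟩⟩
      by_cases hzx : g.SameCycle z x
      · exact .inr hzx
      · exact .inl (hC.1 h3 p hp x hx h2 hzx)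
  have h2 : ∀ p ∈ A, FullCycle A (g * swap p (τ p)) ↔
      ((¬ g.SameCycle z p ∧ g.SameCycle z (τ p)) ∨ (g.SameCycle z p ∧ ¬ g.SameCycle z (τ p))) ∧
        C := by
    intro p hp
    have hw : τ p ∈ A := hτ.1.apply_mem.2 hp
    have hne : τ p ≠ p := by
      obtain ⟨w, hw, hwp⟩ := Finset.exists_mem_ne (show 1 < A.card by omega) p
      exact hτ.apply_ne hp hw hwp.symm
    rw [mul_swap_eq_swap_mul, fullCycle_swap_mul_iff hg (hg.apply_mem.2 hp) (hg.apply_mem.2 hw)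
      (fun h => hne (g.injective h).symm)]
    simp only [Perm.sameCycle_apply_left, Perm.sameCycle_apply_right]
    generalize τ p = w at *
    constructor
    · rintro ⟨h3, h4⟩
      rcases h4 z hz with h5 | h5
      · have h6 : ¬ g.SameCycle z w := fun h => h3 (h5.trans h)
        refine ⟨.inr ⟨h5.symm, h6⟩, hC.2 fun u hu v hv hzu hzv => ?_⟩
        exact ((h4 u hu).resolve_left fun h => hzu (h5.symm.trans h)).symm.trans
          ((h4 v hv).resolve_left fun h => hzv (h5.symm.trans h))
      · have h6 : ¬ g.SameCycle z p := fun h => h3 (h5.trans h).symm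
        refine ⟨.inl ⟨h6, h5.symm⟩, hC.2 fun u hu v hv hzu hzv => ?_⟩
        exact ((h4 u hu).resolve_right fun h => hzu (h5.symm.trans h)).symm.trans
          ((h4 v hv).resolve_right fun h => hzv (h5.symm.trans h))
    · rintro ⟨⟨h3, h4⟩ | ⟨h3, h4⟩, hc⟩
      · refine ⟨fun h => h3 (h4.trans h.symm), fun x hx => ?_⟩
        by_cases hzx : g.SameCycle z x
        · exact .inr (h4.symm.trans hzx)
        · exact .inl (hC.1 hc p hp x hx h3 hzx)
      · refine ⟨fun h => h4 (h3.trans h), fun x hx => ?_⟩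
        by_cases hzx : g.SameCycle z x
        · exact .inl (h3.symm.trans hzx)
        · exact .inr (hC.1 hc w hw x hx h4 hzx)
  have h3 : ∑ p ∈ A, (if (g p ≠ z ∧ FullCycle A (swap (g p) z * g)) ∧ g.SameCycle z (τ p)
        then 1 else 0) =
      ∑ p ∈ A, (if (¬ g.SameCycle z p ∧ C) ∧ g.SameCycle z (τ p) then 1 else 0) :=
    Finset.sum_congr rfl fun p hp => by simp only [h1 p hp]
  have h4 : ∑ p ∈ A, (if FullCycle A (g * swap p (τ p)) then 1 else 0) =
      ∑ p ∈ A, (if ((¬ g.SameCycle z p ∧ g.SameCycle z (τ p)) ∨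
        (g.SameCycle z p ∧ ¬ g.SameCycle z (τ p))) ∧ C then 1 else 0) :=
    Finset.sum_congr rfl fun p hp => by simp only [h2 p hp]
  rw [h3, h4]
  by_cases hc : C
  · have h5 := hτ.1.sum_comp fun p => if g.SameCycle z p then 1 else 0
    have h6 : ∑ p ∈ A, ((if (¬ g.SameCycle z p ∧ C) ∧ g.SameCycle z (τ p) then 1 else 0) +
          if g.SameCycle z p then 1 else 0) =
        ∑ p ∈ A, ((if g.SameCycle z p ∧ ¬ g.SameCycle z (τ p) then 1 else 0) +
          if g.SameCycle z (τ p) then 1 else 0) := by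
      refine Finset.sum_congr rfl fun p _ => ?_
      by_cases ha : g.SameCycle z p <;> by_cases hb : g.SameCycle z (τ p) <;> simp [ha, hb, hc]
    have h7 : ∑ p ∈ A, (if ((¬ g.SameCycle z p ∧ g.SameCycle z (τ p)) ∨
          (g.SameCycle z p ∧ ¬ g.SameCycle z (τ p))) ∧ C then 1 else 0) =
        ∑ p ∈ A, ((if (¬ g.SameCycle z p ∧ C) ∧ g.SameCycle z (τ p) then 1 else 0) +
          if g.SameCycle z p ∧ ¬ g.SameCycle z (τ p) then 1 else 0) := by
      refine Finset.sum_congr rfl fun p _ => ?_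
      by_cases ha : g.SameCycle z p <;> by_cases hb : g.SameCycle z (τ p) <;> simp [ha, hb, hc]
    rw [Finset.sum_add_distrib, Finset.sum_add_distrib] at h6
    rw [h7, Finset.sum_add_distrib]
    omega
  · simp [hc]

/-- For an even permutation `R` of `A`, the anti-exceedances of the full cycles `σ` such that
`R * σ` is a full cycle add up to the number of full cycles. -/
theorem sum_antiExc_of_even (hR : FixesOff A R) (hs : Perm.sign R = 1) (hr : r ∈ A) :
    ∑ σ with FullCycle A σ, (if FullCycle A (R * σ) then antiExc (R * σ) r σ A else 0) =
      (A.card - 1).factorial := by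
  induction hn : A.card using Nat.strong_induction_on generalizing A R r with
  | _ n ih =>
  subst hn
  by_cases hR1 : R = 1
  · rw [← card_fullCycle ⟨r, hr⟩, Finset.card_eq_sum_ones]
    refine Finset.sum_congr rfl fun σ hσ => ?_
    simp only [Finset.mem_filter, Finset.mem_univ, true_and] at hσ
    rw [hR1, one_mul, if_pos hσ, antiExc_self hσ hr]
  obtain ⟨y, hyz⟩ : ∃ y, R y ≠ y := by
    by_contra! h
    exact hR1 (Perm.ext h)
  have hy : y ∈ A := by
    by_contra h
    exact hyz (hR y h)
  set z := R y with hzdef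
  have hz : z ∈ A := hR.apply_mem.2 hy
  set Q := swap y z * R with hQdef
  have hRQ : R = swap y z * Q := by rw [hQdef, ← mul_assoc, swap_mul_self, one_mul]
  have hQy : Q y = y := by rw [hQdef, Perm.mul_apply, ← hzdef, swap_apply_right]
  have hQA : FixesOff A Q := (FixesOff.swap hy hz).mul hR
  have hQA' : FixesOff (A.erase y) Q := hQA.erase hQy
  have hsQ : Perm.sign Q = -1 := by
    rw [hQdef, Perm.sign_mul, Perm.sign_swap (Ne.symm hyz), hs]; rfl
  clear_value Q
  have hzA' : z ∈ A.erase y := Finset.mem_erase.2 ⟨hyz, hz⟩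
  have hcard : (A.erase y).card = A.card - 1 := Finset.card_erase_of_mem hy
  have h2 : 2 ≤ (A.erase y).card := by
    by_contra! h
    rw [hQA'.eq_one (by omega)] at hsQ
    simp at hsQ
  have hroot : ∑ σ with FullCycle A σ,
        (if FullCycle A (R * σ) then antiExc (R * σ) r σ A else 0) =
      ∑ σ with FullCycle A σ,
        (if FullCycle A (R * σ) then antiExc (R * σ) z σ A else 0) := by
    refine Finset.sum_congr rfl fun σ hσ => ?_
    simp only [Finset.mem_filter, Finset.mem_univ, true_and] at hσ
    split_ifs with h
    · exact antiExc_root h hσ.1 hz hr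
    · rfl
  have hstep : ∀ τ ∈ Finset.univ.filter (fun τ : Perm X => FullCycle (A.erase y) τ),
      ∑ p ∈ A.erase y, (if FullCycle A (R * (τ * swap p y)) then
          antiExc (R * (τ * swap p y)) z (τ * swap p y) A else 0) =
        ∑ q ∈ (A.erase y).erase z, (if FullCycle (A.erase y) (swap q z * Q * τ) then
          antiExc (swap q z * Q * τ) z τ (A.erase y) else 0) +
        ∑ p ∈ A.erase y, (if ((Q * τ) p ≠ z ∧ FullCycle (A.erase y)
          (swap ((Q * τ) p) z * (Q * τ))) ∧ (Q * τ).SameCycle z (τ p) then 1 else 0) := by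
    intro τ hτ
    simp only [Finset.mem_filter, Finset.mem_univ, true_and] at hτ
    have hτA : FixesOff A τ := hτ.1.mono (Finset.erase_subset _ _)
    have hgy : (Q * τ) y = y := by rw [Perm.mul_apply, hτ.1 y (by simp), hQy]
    have h1 : ∑ q ∈ (A.erase y).erase z, (if FullCycle (A.erase y) (swap q z * Q * τ) then
          antiExc (swap q z * Q * τ) z τ (A.erase y) else 0) =
        ∑ p ∈ A.erase y, (if (Q * τ) p ≠ z ∧ FullCycle (A.erase y)
          (swap ((Q * τ) p) z * (Q * τ)) then
            antiExc (swap ((Q * τ) p) z * (Q * τ)) z τ (A.erase y) else 0) := by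
      rw [(hQA'.mul hτ.1).sum_comp (fun q => if q ≠ z ∧ FullCycle (A.erase y)
        (swap q z * (Q * τ)) then antiExc (swap q z * (Q * τ)) z τ (A.erase y) else 0)]
      rw [← Finset.add_sum_erase (A.erase y) _ hzA']
      simp only [ne_eq, not_true_eq_false, false_and, if_false, zero_add]
      refine Finset.sum_congr rfl fun q hq => ?_
      simp only [Finset.ne_of_mem_erase hq, not_false_eq_true, true_and, mul_assoc]
    rw [h1, ← Finset.sum_add_distrib]
    refine Finset.sum_congr rfl fun p hp => ?_
    have e : R * (τ * swap p y) = swap y z * ((Q * τ) * swap p y) := by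
      rw [hRQ]; simp only [mul_assoc]
    have hiff := fullCycle_swap_mul_mul_swap_iff (hQA.mul hτA) hy hgy hzA' hp
    rw [e]
    by_cases hc : (Q * τ) p ≠ z ∧ FullCycle (A.erase y) (swap ((Q * τ) p) z * (Q * τ))
    · rw [if_pos (hiff.2 hc), if_pos hc,
        antiExc_insert (hQA.mul hτA) hy hgy hτ.1 hzA' hp hc.1 hc.2]
      simp only [hc, ne_eq, not_false_eq_true, true_and]
    · rw [if_neg (fun h => hc (hiff.1 h)), if_neg hc, if_neg (fun h => hc h.1)]
  rw [hroot, sum_fullCycle_insert hy ⟨z, hzA'⟩, Finset.sum_congr rfl hstep,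
    Finset.sum_add_distrib, Finset.sum_comm]
  have hfirst : ∀ q ∈ (A.erase y).erase z, ∑ τ with FullCycle (A.erase y) τ,
      (if FullCycle (A.erase y) (swap q z * Q * τ) then
          antiExc (swap q z * Q * τ) z τ (A.erase y) else 0) = (A.card - 2).factorial := by
    intro q hq
    have hq' := Finset.mem_erase.1 hq
    rw [ih (A.erase y).card (by omega) ((FixesOff.swap hq'.2 hzA').mul hQA') (by
      rw [Perm.sign_mul, Perm.sign_swap hq'.1, hsQ]; rfl) hzA' rfl, hcard]
    rfl
  rw [Finset.sum_congr rfl hfirst, Finset.sum_const, Finset.card_erase_of_mem hzA', hcard]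
  have hsecond := sum_fullCycle_mul_swap_apply hQA' hsQ
  rw [Finset.sum_congr rfl fun τ hτ => (two_mul_sum_sameCycle_apply (z := z) (τ := τ)
    (hQA'.mul (Finset.mem_filter.1 hτ).2.1) (Finset.mem_filter.1 hτ).2 hzA' h2).symm,
    ← Finset.mul_sum] at hsecond
  have h3 := Nat.eq_of_mul_eq_mul_left two_pos hsecond
  rw [h3, hcard]
  obtain ⟨k, hk⟩ : ∃ k, A.card = k + 2 := ⟨A.card - 2, by omega⟩
  rw [hk]
  simp only [Nat.add_sub_cancel, show k + 2 - 1 = k + 1 from rfl, smul_eq_mul,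
    Nat.factorial_succ]
  ring

end AntiExceedances

section Blocks

set_option linter.unusedSectionVars false

variable {X : Type*} [DecidableEq X] [Fintype X] {A B : Finset X} {s g σ τ Q R D π : Perm X}
  {r a b p x y z : X}

theorem FullCycle.sign (h : FullCycle A s) (hA : A.Nonempty) :
    Perm.sign s = (-1) ^ (A.card + 1) := by
  by_cases h1 : A.card = 1
  · rw [(fullCycle_iff_of_card_eq_one h1).1 h, h1]
    simp
  · have h2 : 1 < A.card := by
      have := hA.card_pos
      omega
    have hne : ∀ x ∈ A, s x ≠ x := fun x hx => by
      obtain ⟨w, hw, hwx⟩ := Finset.exists_mem_ne h2 x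
      exact h.apply_ne hx hw hwx.symm
    have hmem : ∀ x, s x ≠ x → x ∈ A := fun x hx => by
      by_contra hn
      exact hx (h.1 x hn)
    have hsupp : s.support = A := by
      ext x
      rw [Perm.mem_support]
      exact ⟨hmem x, hne x⟩
    obtain ⟨x, hx⟩ := hA
    have hc : s.IsCycle := ⟨x, hne x hx, fun y hy => h.2 x hx y (hmem y hy)⟩
    rw [hc.sign, hsupp, pow_succ]
    simp

theorem antiExc_add_antiExc (h : FullCycle A (D * π)) (hπ : FixesOff A π) (hr : r ∈ A) :
    antiExc (D * π) r π A + antiExc (D * π) r D A = A.card + 1 := by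
  have h1 : antiExc (D * π) r D A =
      ∑ u ∈ A, if pos (D * π) r ((D * π) u) ≤ pos (D * π) r (π u) then 1 else 0 := by
    rw [antiExc, Finset.card_filter, ← hπ.sum_comp]
    rfl
  have h2 : ∑ u ∈ A, (if (D * π) u = r then 1 else 0) = 1 := by
    rw [h.1.sum_comp (fun q => if q = r then 1 else 0)]
    simp [hr]
  rw [h1, antiExc, Finset.card_filter, ← Finset.sum_add_distrib]
  conv_rhs => rw [← h2, Finset.card_eq_sum_ones, ← Finset.sum_add_distrib]
  refine Finset.sum_congr rfl fun u hu => ?_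
  have hπu : π u ∈ A := hπ.apply_mem.2 hu
  by_cases hur : (D * π) u = r
  · rw [if_pos (h.pos_le_last hr hur hu hπu), if_pos hur, hur, pos_self, if_pos (Nat.zero_le _)]
  · rw [if_neg hur, h.pos_apply hr hu hur]
    split_ifs <;> omega

theorem antiExc_conj (s D : Perm X) (r : X) (hD : FixesOff A D) :
    antiExc (D⁻¹ * s * D) (D⁻¹ r) D A = antiExc s r D A := by
  have hpos : ∀ x, pos (D⁻¹ * s * D) (D⁻¹ r) x = pos s r (D x) := by
    intro x
    rw [pos, pos]
    congr 1
    ext i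
    have : (D⁻¹ * s * D) ^ i = D⁻¹ * s ^ i * D := by
      simpa using conj_pow (a := D⁻¹) (b := s) (i := i)
    simp only [Set.mem_ofPred_eq, this, Perm.mul_apply, perm_apply_inv, Perm.inv_eq_iff_eq]
  simp only [antiExc, hpos, Finset.card_filter]
  exact hD.sum_comp fun x => if pos s r (D x) ≤ pos s r x then 1 else 0

/-- The anti-exceedances on `B` of the full cycles `σ` on `B` such that `R * σ` is a full cycle
are equinumerous with the permutations of `B` with an odd number of cycles having this property. -/
theorem sum_antiExc_eq_card (hR : FixesOff A R) (hBA : B ⊆ A) (hB : B.Nonempty) (hr : r ∈ A) :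
    ∑ σ with FullCycle B σ, (if FullCycle A (R * σ) then antiExc (R * σ) r σ B else 0) =
      (Finset.univ.filter fun σ : Perm X => FixesOff B σ ∧ FullCycle A (R * σ) ∧
        Perm.sign σ = (-1) ^ (B.card + 1)).card := by
  induction hn : A.card using Nat.strong_induction_on generalizing A R r with
  | _ n ih =>
  subst hn
  by_cases hAB : A ⊆ B
  · obtain rfl := Finset.Subset.antisymm hAB hBA
    rcases Int.units_eq_one_or (Perm.sign R) with hs | hs
    · rw [sum_antiExc_of_even hR hs hr, ← card_fullCycle hB]
      refine Finset.card_bij' (fun s _ => R⁻¹ * s) (fun σ _ => R * σ) ?_ ?_ ?_ ?_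
      · intro s h
        simp only [Finset.mem_filter, Finset.mem_univ, true_and] at h ⊢
        refine ⟨hR.inv.mul h.1, by simpa using h, ?_⟩
        rw [Perm.sign_mul, Perm.sign_inv, hs, one_mul, h.sign hB]
      · intro σ h
        simp only [Finset.mem_filter, Finset.mem_univ, true_and] at h ⊢
        exact h.2.1
      · simp
      · simp
    · have hnot : ∀ σ, FullCycle A (R * σ) → Perm.sign σ ≠ (-1) ^ (A.card + 1) := by
        intro σ h1 h2
        have h3 := h1.sign hB
        rw [Perm.sign_mul, hs, h2] at h3
        rcases neg_one_pow_eq_or ℤˣ (A.card + 1) with h4 | h4 <;> rw [h4] at h3 <;> simp at h3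
      rw [Finset.sum_eq_zero, eq_comm, Finset.card_eq_zero, Finset.filter_eq_empty_iff]
      · rintro σ - ⟨-, h1, h2⟩
        exact hnot σ h1 h2
      · intro σ hσ
        simp only [Finset.mem_filter, Finset.mem_univ, true_and] at hσ
        rw [if_neg fun h => hnot σ h (hσ.sign hB)]
  · obtain ⟨y, hy, hyB⟩ := Finset.not_subset.1 hAB
    obtain ⟨b, hb⟩ := hB
    have hby : b ≠ y := fun h => hyB (h ▸ hb)
    by_cases hw : R y = y
    · have hnot : ∀ σ, FixesOff B σ → ¬ FullCycle A (R * σ) := by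
        intro σ h1 h2
        exact h2.apply_ne hy (hBA hb) hby.symm (by rw [Perm.mul_apply, h1 y hyB, hw])
      rw [Finset.sum_eq_zero, eq_comm, Finset.card_eq_zero, Finset.filter_eq_empty_iff]
      · rintro σ - ⟨h0, h1, -⟩
        exact hnot σ h0 h1
      · intro σ hσ
        simp only [Finset.mem_filter, Finset.mem_univ, true_and] at hσ
        rw [if_neg (hnot σ hσ.1)]
    · have hwA : R y ∈ A := hR.apply_mem.2 hy
      obtain ⟨R', hR'⟩ : ∃ R', R' = swap y (R y) * R := ⟨_, rfl⟩
      have hRR' : R = swap y (R y) * R' := by rw [hR', ← mul_assoc, swap_mul_self, one_mul]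
      have hR'y : R' y = y := by rw [hR', Perm.mul_apply, swap_apply_right]
      have hR'A : FixesOff A R' := hR' ▸ (FixesOff.swap hy hwA).mul hR
      have hwA' : R y ∈ A.erase y := Finset.mem_erase.2 ⟨hw, hwA⟩
      have hBA' : B ⊆ A.erase y := fun x hx =>
        Finset.mem_erase.2 ⟨fun h => hyB (h ▸ hx), hBA hx⟩
      have hiff : ∀ σ, FixesOff B σ →
          (FullCycle A (R * σ) ↔ FullCycle (A.erase y) (R' * σ)) := by
        intro σ hσ
        have := fullCycle_swap_mul_iff_erase (hR'A.mul (hσ.mono hBA)) hwA hy (Ne.symm hw)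
          (by rw [Perm.mul_apply, hσ y hyB, hR'y])
        rwa [← mul_assoc, ← hRR'] at this
      obtain ⟨r', hr', hrr'⟩ : ∃ r' ∈ A.erase y, (r ≠ y ∧ r' = r) ∨ (r = y ∧ r' = R y) := by
        by_cases hry : r = y
        · exact ⟨R y, hwA', .inr ⟨hry, rfl⟩⟩
        · exact ⟨r, Finset.mem_erase.2 ⟨hry, hr⟩, .inl ⟨hry, rfl⟩⟩
      have hanti : ∀ σ, FixesOff B σ → FullCycle A (R * σ) →
          antiExc (R * σ) r σ B = antiExc (R' * σ) r' σ B := by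
        intro σ hσ h
        have h' := (hiff σ hσ).1 h
        have hsy : (R * σ) y = R y := by rw [Perm.mul_apply, hσ y hyB]
        have hf : ∀ x ∈ A.erase y, (R' * σ) x ≠ r' →
            pos (R * σ) r x < pos (R * σ) r ((R' * σ) x) := by
          intro x hx hxr
          obtain ⟨hxy, hxA⟩ := Finset.mem_erase.1 hx
          have e : (R' * σ) x = swap y (R y) ((R * σ) x) := by rw [hR']; rfl
          rw [e] at hxr ⊢
          by_cases h1 : (R * σ) x = y
          · rw [h1, swap_apply_left] at hxr ⊢
            rcases hrr' with ⟨h2, rfl⟩ | ⟨-, rfl⟩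
            · rw [← hsy, h.pos_apply hr hy (by rwa [hsy]), ← h1,
                h.pos_apply hr hxA (by rw [h1]; exact h2.symm)]
              omega
            · exact absurd rfl hxr
          · have h2 : (R * σ) x ≠ R y := fun h2 =>
              hxy ((R * σ).injective (h2.trans hsy.symm))
            rw [swap_apply_of_ne_of_ne h1 h2] at hxr ⊢
            have h3 : (R * σ) x ≠ r := by
              rcases hrr' with ⟨-, rfl⟩ | ⟨rfl, -⟩
              · exact hxr
              · exact h1
            rw [h.pos_apply hr hxA h3]
            omega
        rw [antiExc, antiExc]
        congr 1
        refine Finset.filter_congr fun x hx => ?_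
        exact h'.le_iff_pos_le hr' hf (hBA' (hσ.apply_mem.2 hx)) (hBA' hx)
      have hlt : (A.erase y).card < A.card := Finset.card_erase_lt_of_mem hy
      have key := ih _ hlt (hR'A.erase hR'y) hBA' hr' rfl
      have hl : ∑ σ with FullCycle B σ,
            (if FullCycle A (R * σ) then antiExc (R * σ) r σ B else 0) =
          ∑ σ with FullCycle B σ,
            (if FullCycle (A.erase y) (R' * σ) then antiExc (R' * σ) r' σ B else 0) := by
        refine Finset.sum_congr rfl fun σ hσ => ?_
        simp only [Finset.mem_filter, Finset.mem_univ, true_and] at hσ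
        by_cases hc : FullCycle A (R * σ)
        · rw [if_pos hc, if_pos ((hiff σ hσ.1).1 hc), hanti σ hσ.1 hc]
        · rw [if_neg hc, if_neg fun h => hc ((hiff σ hσ.1).2 h)]
      rw [hl, key]
      congr 1
      refine Finset.filter_congr fun σ _ => and_congr_right fun hσ => ?_
      rw [hiff σ hσ]

end Blocks

section CycleSets

set_option linter.unusedSectionVars false

variable {X : Type*} [DecidableEq X] [Fintype X] {A B : Finset X} {s g σ τ Q R D π : Perm X}
  {r a b p x y z : X}

/-- The cycles of `σ`, fixed points included, as sets of points. -/
def cycleSets (σ : Perm X) : Finset (Finset X) :=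
  Finset.univ.image fun x => Finset.univ.filter fun y => σ.SameCycle x y

theorem mem_cycleSets : B ∈ cycleSets σ ↔ ∃ x, ∀ y, y ∈ B ↔ σ.SameCycle x y := by
  simp only [cycleSets, Finset.mem_image, Finset.mem_univ, true_and, Finset.ext_iff,
    Finset.mem_filter]
  exact exists_congr fun x => forall_congr' fun y => Iff.comm

theorem mem_iff_of_mem_cycleSets (hB : B ∈ cycleSets σ) (hx : x ∈ B) :
    y ∈ B ↔ σ.SameCycle x y := by
  obtain ⟨w, hw⟩ := mem_cycleSets.1 hB
  rw [hw y]
  exact ⟨fun h => ((hw x).1 hx).symm.trans h, fun h => ((hw x).1 hx).trans h⟩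

theorem nonempty_of_mem_cycleSets (hB : B ∈ cycleSets σ) : B.Nonempty := by
  obtain ⟨w, hw⟩ := mem_cycleSets.1 hB
  exact ⟨w, (hw w).2 (.refl _ _)⟩

theorem eq_of_mem_cycleSets (hA : A ∈ cycleSets σ) (hB : B ∈ cycleSets σ) (hxA : x ∈ A)
    (hxB : x ∈ B) : A = B := by
  ext y
  rw [mem_iff_of_mem_cycleSets hA hxA, mem_iff_of_mem_cycleSets hB hxB]

theorem exists_mem_cycleSets (σ : Perm X) (x : X) : ∃ B ∈ cycleSets σ, x ∈ B :=
  ⟨Finset.univ.filter fun y => σ.SameCycle x y, mem_cycleSets.2 ⟨x, by simp⟩,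
    by simpa using Perm.SameCycle.refl σ x⟩

theorem singleton_mem_cycleSets : {x} ∈ cycleSets σ ↔ σ x = x := by
  constructor
  · intro h
    have := (mem_iff_of_mem_cycleSets h (Finset.mem_singleton_self x) (y := σ x)).2
      (Perm.sameCycle_apply_right.2 (.refl _ _))
    simpa using this
  · intro h
    refine mem_cycleSets.2 ⟨x, fun y => ?_⟩
    rw [Finset.mem_singleton]
    constructor
    · rintro rfl
      exact .refl _ _
    · intro hxy
      exact sameCycle_of_forall (P := fun z => z = x) (by rintro _ rfl; exact h) rfl hxy

theorem partition_parts_eq (σ : Perm X) :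
    σ.partition.parts = (cycleSets σ).val.map Finset.card := by
  have h1 : cycleSets σ = σ.cycleFactorsFinset.image Perm.support ∪
      (σ.supportᶜ).image (fun x => {x}) := by
    ext B
    simp only [Finset.mem_union, Finset.mem_image, Finset.mem_compl]
    constructor
    · intro hB
      obtain ⟨x, hx⟩ := mem_cycleSets.1 hB
      by_cases hxs : x ∈ σ.support
      · left
        refine ⟨σ.cycleOf x, Perm.cycleOf_mem_cycleFactorsFinset_iff.2 hxs, ?_⟩
        ext y
        rw [Perm.mem_support_cycleOf_iff, hx y]
        simp [hxs]
      · right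
        refine ⟨x, hxs, ?_⟩
        rw [Perm.notMem_support] at hxs
        exact eq_of_mem_cycleSets (singleton_mem_cycleSets.2 hxs) hB (Finset.mem_singleton_self x)
          ((hx x).2 (.refl _ _))
    · rintro (⟨c, hc, rfl⟩ | ⟨x, hx, rfl⟩)
      · obtain ⟨x, hx⟩ := (Perm.mem_cycleFactorsFinset_iff.1 hc).1.nonempty_support
        refine mem_cycleSets.2 ⟨x, fun y => ?_⟩
        have hxs := Perm.mem_cycleFactorsFinset_support_le hc hx
        rw [Perm.cycle_is_cycleOf hx hc, Perm.mem_support_cycleOf_iff]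
        simp [hxs]
      · exact singleton_mem_cycleSets.2 (Perm.notMem_support.1 hx)
  have hdisj : Disjoint (σ.cycleFactorsFinset.image Perm.support)
      ((σ.supportᶜ).image (fun x => ({x} : Finset X))) := by
    rw [Finset.disjoint_left]
    simp only [Finset.mem_image, Finset.mem_compl, not_exists, not_and]
    rintro _ ⟨c, hc, rfl⟩ x hx hxc
    refine hx (Perm.mem_cycleFactorsFinset_support_le hc ?_)
    rw [← hxc]
    exact Finset.mem_singleton_self x
  have hinj : Set.InjOn Perm.support (σ.cycleFactorsFinset : Set (Perm X)) := by
    intro c hc d hd hcd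
    obtain ⟨x, hx⟩ := (Perm.mem_cycleFactorsFinset_iff.1 hc).1.nonempty_support
    rw [Perm.cycle_is_cycleOf hx hc]
    exact (Perm.cycle_is_cycleOf (hcd ▸ hx) hd).symm
  rw [h1, ← Finset.disjUnion_eq_union _ _ hdisj, Finset.disjUnion_val, Multiset.map_add,
    Finset.image_val_of_injOn hinj,
    Finset.image_val_of_injOn (Finset.singleton_injective.injOn), Multiset.map_map,
    Multiset.map_map, Perm.parts_partition, Perm.cycleType_def]
  congr 1
  rw [← Finset.card_compl]
  symm
  refine Multiset.eq_replicate.2 ⟨by simp, fun k hk => ?_⟩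
  obtain ⟨x, -, rfl⟩ := Multiset.mem_map.1 hk
  rfl

theorem card_cycleSets (σ : Perm X) : (cycleSets σ).card = σ.partition.parts.card := by
  rw [partition_parts_eq, Multiset.card_map]
  rfl

theorem sign_eq_pow_card_cycleSets (σ : Perm X) :
    Perm.sign σ = (-1) ^ (Fintype.card X + (cycleSets σ).card) := by
  rw [card_cycleSets, Perm.parts_partition, Multiset.card_add, Multiset.card_replicate,
    Perm.sign_of_cycleType, Perm.sum_cycleType]
  have := Finset.card_le_univ σ.support
  obtain ⟨k, hk⟩ := Nat.exists_eq_add_of_le this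
  rw [hk, Nat.add_sub_cancel_left]
  have : σ.support.card + k + (σ.cycleType.card + k) =
      σ.support.card + σ.cycleType.card + 2 * k := by ring
  rw [this, pow_add _ _ (2 * k), pow_mul]
  simp

/-- The cycles of `σ` lying inside `B`. -/
def cyclesIn (σ : Perm X) (B : Finset X) : Finset (Finset X) :=
  (cycleSets σ).filter fun O => O ⊆ B

theorem sameCycle_iff_of_eqOn {P : X → Prop} (h : ∀ x, P x → σ x = τ x) (hτ : ∀ x, P x → P (τ x))
    (hx : P x) : σ.SameCycle x y ↔ τ.SameCycle x y := by
  have key : ∀ i : ℕ, P ((τ ^ i) x) ∧ (σ ^ i) x = (τ ^ i) x := by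
    intro i
    induction i with
    | zero => simpa
    | succ i ih =>
      rw [pow_succ', pow_succ', Perm.mul_apply, Perm.mul_apply, ih.2]
      exact ⟨hτ _ ih.1, h _ ih.1⟩
  constructor
  · intro hs
    obtain ⟨i, rfl⟩ := exists_pow_of_sameCycle hs
    exact ⟨i, by rw [zpow_natCast, (key i).2]⟩
  · intro hs
    obtain ⟨i, rfl⟩ := exists_pow_of_sameCycle hs
    exact ⟨i, by rw [zpow_natCast, (key i).2]⟩

theorem mem_cycleSets_iff_of_eqOn {P : X → Prop} (h : ∀ x, P x → σ x = τ x)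
    (hτ : ∀ x, P x → P (τ x)) (hB : ∃ x ∈ B, P x) : B ∈ cycleSets σ ↔ B ∈ cycleSets τ := by
  obtain ⟨w, hwB, hw⟩ := hB
  constructor
  · intro hB
    exact mem_cycleSets.2 ⟨w, fun y => (mem_iff_of_mem_cycleSets hB hwB).trans
      (sameCycle_iff_of_eqOn h hτ hw)⟩
  · intro hB
    exact mem_cycleSets.2 ⟨w, fun y => (mem_iff_of_mem_cycleSets hB hwB).trans
      (sameCycle_iff_of_eqOn h hτ hw).symm⟩

theorem mul_apply_of_mem {σ₀ : Perm X} (h0 : FixesOff Bᶜ σ₀) (hτ : FixesOff B τ) (hx : x ∈ B) :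
    (σ₀ * τ) x = τ x :=
  h0 _ (by simpa using hτ.apply_mem.2 hx)

theorem mul_apply_of_notMem {σ₀ : Perm X} (hτ : FixesOff B τ) (hx : x ∉ B) :
    (σ₀ * τ) x = σ₀ x := by
  rw [Perm.mul_apply, hτ x hx]

theorem cyclesIn_mul {σ₀ : Perm X} (h0 : FixesOff Bᶜ σ₀) (hτ : FixesOff B τ) :
    cyclesIn (σ₀ * τ) B = cyclesIn τ B := by
  ext O
  simp only [cyclesIn, Finset.mem_filter]
  by_cases hO : O.Nonempty
  · refine and_congr_left fun hOB => ?_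
    obtain ⟨x, hx⟩ := hO
    exact mem_cycleSets_iff_of_eqOn (P := fun x => x ∈ B) (fun x hx => mul_apply_of_mem h0 hτ hx)
      (fun x hx => hτ.apply_mem.2 hx) ⟨x, hx, hOB hx⟩
  · exact iff_of_false (fun h => hO (nonempty_of_mem_cycleSets h.1))
      (fun h => hO (nonempty_of_mem_cycleSets h.1))

theorem cycleSets_sdiff_mul {σ₀ : Perm X} (h0 : FixesOff Bᶜ σ₀) (hτ : FixesOff B τ) :
    cycleSets (σ₀ * τ) \ cyclesIn (σ₀ * τ) B = cycleSets σ₀ \ cyclesIn σ₀ B := by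
  ext O
  simp only [cyclesIn, Finset.mem_sdiff, Finset.mem_filter, not_and]
  by_cases hO : O ⊆ B
  · exact iff_of_false (fun h => h.2 h.1 hO) (fun h => h.2 h.1 hO)
  · simp only [hO, not_false_eq_true, implies_true, and_true]
    obtain ⟨x, hx, hxB⟩ := Finset.not_subset.1 hO
    exact mem_cycleSets_iff_of_eqOn (P := fun x => x ∉ B)
      (fun x hx => mul_apply_of_notMem hτ hx)
      (fun x hx => by simpa using h0.apply_mem.2 (Finset.mem_compl.2 hx)) ⟨x, hx, hxB⟩

theorem mem_cycleSets_mul_iff {σ₀ : Perm X} (h0 : FixesOff Bᶜ σ₀) (hτ : FixesOff B τ)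
    (hB : B.Nonempty) : B ∈ cycleSets (σ₀ * τ) ↔ FullCycle B τ := by
  obtain ⟨x, hx⟩ := hB
  rw [mem_cycleSets_iff_of_eqOn (P := fun x => x ∈ B)
    (fun x hx => mul_apply_of_mem h0 hτ hx) (fun x hx => hτ.apply_mem.2 hx) ⟨x, hx, hx⟩]
  constructor
  · intro h
    exact ⟨hτ, fun u hu v hv => (mem_iff_of_mem_cycleSets h hu).1 hv⟩
  · intro h
    exact mem_cycleSets.2 ⟨x, fun y => ⟨fun hy => h.2 x hx y hy,
      fun hy => hτ.mem_of_sameCycle hx hy⟩⟩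

theorem insert_cycleSets_sdiff (hB : B ∈ cycleSets σ) :
    insert B (cycleSets σ \ cyclesIn σ B) = cycleSets σ := by
  ext O
  simp only [cyclesIn, Finset.mem_insert, Finset.mem_sdiff, Finset.mem_filter, not_and]
  constructor
  · rintro (rfl | h)
    · exact hB
    · exact h.1
  · intro hO
    by_cases hOB : O ⊆ B
    · left
      obtain ⟨x, hx⟩ := nonempty_of_mem_cycleSets hO
      exact eq_of_mem_cycleSets hO hB hx (hOB hx)
    · exact .inr ⟨hO, fun _ => hOB⟩

theorem odd_card_cyclesIn_iff (hτ : FixesOff B τ) :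
    Odd (cyclesIn τ B).card ↔ Perm.sign τ = (-1) ^ (B.card + 1) := by
  have h1 : cycleSets τ \ cyclesIn τ B = Bᶜ.image fun x => {x} := by
    ext O
    simp only [cyclesIn, Finset.mem_sdiff, Finset.mem_filter, not_and, Finset.mem_image,
      Finset.mem_compl]
    constructor
    · rintro ⟨hO, hOB⟩
      obtain ⟨x, hx, hxB⟩ := Finset.not_subset.1 (hOB hO)
      exact ⟨x, hxB, eq_of_mem_cycleSets (singleton_mem_cycleSets.2 (hτ x hxB)) hO
        (Finset.mem_singleton_self x) hx⟩
    · rintro ⟨x, hx, rfl⟩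
      exact ⟨singleton_mem_cycleSets.2 (hτ x hx), fun _ h => hx (h (Finset.mem_singleton_self x))⟩
  have h2 : (cycleSets τ).card = (cyclesIn τ B).card + Bᶜ.card := by
    rw [← Finset.card_image_of_injective Bᶜ Finset.singleton_injective, ← h1,
      Finset.card_sdiff_of_subset (s := cyclesIn τ B) (Finset.filter_subset _ _)]
    have := Finset.card_le_card (Finset.filter_subset (fun O => O ⊆ B) (cycleSets τ))
    rw [← cyclesIn] at this
    omega
  have h3 : Fintype.card X = B.card + Bᶜ.card := (Finset.card_add_card_compl B).symm
  rw [sign_eq_pow_card_cycleSets, h2, h3]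
  generalize (cyclesIn τ B).card = c
  generalize Bᶜ.card = d
  have : B.card + d + (c + d) = B.card + c + 2 * d := by ring
  rw [this, pow_add _ _ (2 * d), pow_mul, neg_one_sq, one_pow, mul_one, pow_add, pow_add,
    mul_right_inj, pow_one]
  rcases Nat.even_or_odd c with hc | hc
  · rw [hc.neg_one_pow]
    exact iff_of_false (Nat.not_odd_iff_even.2 hc) (by decide)
  · rw [hc.neg_one_pow]
    simp [hc]

end CycleSets

section Gluing

set_option linter.unusedSectionVars false

variable {X : Type*} [DecidableEq X] [Fintype X] {A B : Finset X} {s g σ τ Q R D π : Perm X}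
  {r a b p x y z : X}

theorem sum_invariant {M : Type*} [AddCommMonoid M] (B : Finset X) (F : Perm X → M) :
    ∑ σ : Perm X with (∀ x ∈ B, σ x ∈ B), F σ =
      ∑ σ₀ : Perm X with FixesOff Bᶜ σ₀, ∑ τ : Perm X with FixesOff B τ, F (σ₀ * τ) := by
  rw [← Finset.sum_product']
  symm
  refine Finset.sum_bij (fun q _ => q.1 * q.2) ?_ ?_ ?_ (fun _ _ => rfl)
  · rintro ⟨σ₀, τ⟩ hq
    simp only [Finset.mem_product, Finset.mem_filter, Finset.mem_univ, true_and] at hq ⊢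
    intro x hx
    rw [mul_apply_of_mem hq.1 hq.2 hx]
    exact hq.2.apply_mem.2 hx
  · rintro ⟨σ₀, τ⟩ hq ⟨σ₀', τ'⟩ hq' heq
    simp only [Finset.mem_product, Finset.mem_filter, Finset.mem_univ, true_and] at hq hq' heq
    have hτ : τ = τ' := by
      ext x
      by_cases hx : x ∈ B
      · rw [← mul_apply_of_mem hq.1 hq.2 hx, heq, mul_apply_of_mem hq'.1 hq'.2 hx]
      · rw [hq.2 x hx, hq'.2 x hx]
    rw [hτ] at heq
    rw [hτ, mul_right_cancel heq]
  · intro σ hσ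
    simp only [Finset.mem_filter, Finset.mem_univ, true_and] at hσ
    have hinv : ∀ x, σ x ∈ B ↔ x ∈ B := by
      intro x
      refine ⟨fun h => ?_, hσ x⟩
      have himg : B.map σ.toEmbedding = B :=
        Finset.eq_of_subset_of_card_le
          (by
            intro w hw
            obtain ⟨v, hv, rfl⟩ := Finset.mem_map.1 hw
            exact hσ v hv)
          (Finset.card_map _).ge
      rw [← himg] at h
      simpa using h
    set τ : Perm X := Perm.ofSubtype (σ.subtypePerm hinv) with hτdef
    have hτ1 : ∀ x ∈ B, τ x = σ x := fun x hx => by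
      rw [hτdef, Perm.ofSubtype_apply_of_mem _ hx]
      rfl
    have hτ : FixesOff B τ := fun x hx => Perm.ofSubtype_apply_of_not_mem _ hx
    refine ⟨(σ * τ⁻¹, τ), ?_, by simp⟩
    simp only [Finset.mem_product, Finset.mem_filter, Finset.mem_univ, true_and]
    refine ⟨fun x hx => ?_, hτ⟩
    rw [Finset.mem_compl, not_not] at hx
    rw [Perm.mul_apply, ← hτ1 _ (hτ.inv.apply_mem.2 hx), perm_apply_inv]

theorem apply_mem_of_mem_cycleSets (hB : B ∈ cycleSets σ) (hx : x ∈ B) : σ x ∈ B :=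
  (mem_iff_of_mem_cycleSets hB hx).2 (Perm.sameCycle_apply_right.2 (.refl _ _))

theorem cyclesIn_sup {T : Finset (Finset X)} (hT : T ⊆ cycleSets σ) :
    cyclesIn σ (T.sup id) = T := by
  ext O
  simp only [cyclesIn, Finset.mem_filter]
  constructor
  · rintro ⟨hO, hOT⟩
    obtain ⟨x, hx⟩ := nonempty_of_mem_cycleSets hO
    obtain ⟨O', hO', hx'⟩ := Finset.mem_sup.1 (hOT hx)
    rwa [eq_of_mem_cycleSets hO (hT hO') hx hx']
  · intro hO
    exact ⟨hT hO, Finset.le_sup (f := id) hO⟩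

theorem sup_cyclesIn (hB : ∀ x ∈ B, σ x ∈ B) : (cyclesIn σ B).sup id = B := by
  apply le_antisymm
  · exact Finset.sup_le fun O hO => (Finset.mem_filter.1 hO).2
  · intro x hx
    obtain ⟨O, hO, hxO⟩ := exists_mem_cycleSets σ x
    refine Finset.mem_sup.2 ⟨O, Finset.mem_filter.2 ⟨hO, fun y hy => ?_⟩, hxO⟩
    exact sameCycle_of_forall (P := fun x => x ∈ B) hB hx ((mem_iff_of_mem_cycleSets hO hxO).1 hy)

/-- Anti-exceedances lying in a cycle of `σ` correspond to choices of an odd number of cycles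
to be glued into that cycle. -/
theorem sum_antiExc_cycleSets (R : Perm X) (r : X) (Φ : Finset (Finset X) → Finset X → ℕ) :
    ∑ σ with FullCycle Finset.univ (R * σ), ∑ B ∈ cycleSets σ,
        antiExc (R * σ) r σ B * Φ (cycleSets σ) B =
      ∑ σ with FullCycle Finset.univ (R * σ), ∑ T ∈ (cycleSets σ).powerset with Odd T.card,
        Φ (insert (T.sup id) (cycleSets σ \ T)) (T.sup id) := by
  have hL : ∀ σ : Perm X, ∑ B ∈ cycleSets σ, antiExc (R * σ) r σ B * Φ (cycleSets σ) B =
      ∑ B : Finset X with B.Nonempty, if ∀ x ∈ B, σ x ∈ B then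
        (if B ∈ cycleSets σ then antiExc (R * σ) r σ B *
          Φ (insert B (cycleSets σ \ cyclesIn σ B)) B else 0) else 0 := by
    intro σ
    rw [← Finset.sum_filter, ← Finset.sum_filter]
    refine Finset.sum_congr ?_ fun B hB => ?_
    · ext B
      simp only [Finset.mem_filter, Finset.mem_univ, true_and]
      exact ⟨fun h => ⟨⟨nonempty_of_mem_cycleSets h, fun x hx =>
        apply_mem_of_mem_cycleSets h hx⟩, h⟩, fun h => h.2⟩
    · rw [insert_cycleSets_sdiff (Finset.mem_filter.1 hB).2]
  have hR : ∀ σ : Perm X, ∑ T ∈ (cycleSets σ).powerset with Odd T.card,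
        Φ (insert (T.sup id) (cycleSets σ \ T)) (T.sup id) =
      ∑ B : Finset X with B.Nonempty, if ∀ x ∈ B, σ x ∈ B then
        (if Odd (cyclesIn σ B).card then
          Φ (insert B (cycleSets σ \ cyclesIn σ B)) B else 0) else 0 := by
    intro σ
    rw [← Finset.sum_filter, ← Finset.sum_filter]
    refine Finset.sum_bij' (fun T _ => T.sup id) (fun B _ => cyclesIn σ B) ?_ ?_ ?_ ?_ ?_
    · intro T hT
      simp only [Finset.mem_filter, Finset.mem_powerset, Finset.mem_univ, true_and] at hT ⊢
      rw [cyclesIn_sup hT.1]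
      refine ⟨⟨?_, fun x hx => ?_⟩, hT.2⟩
      · obtain ⟨O, hO⟩ := Finset.card_pos.1 hT.2.pos
        obtain ⟨x, hx⟩ := nonempty_of_mem_cycleSets (hT.1 hO)
        exact ⟨x, Finset.mem_sup.2 ⟨O, hO, hx⟩⟩
      · obtain ⟨O, hO, hxO⟩ := Finset.mem_sup.1 hx
        exact Finset.mem_sup.2 ⟨O, hO, apply_mem_of_mem_cycleSets (hT.1 hO) hxO⟩
    · intro B hB
      simp only [Finset.mem_filter, Finset.mem_powerset, Finset.mem_univ, true_and] at hB ⊢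
      exact ⟨Finset.filter_subset _ _, hB.2⟩
    · intro T hT
      simp only [Finset.mem_filter, Finset.mem_powerset] at hT
      exact cyclesIn_sup hT.1
    · intro B hB
      simp only [Finset.mem_filter, Finset.mem_univ, true_and] at hB
      exact sup_cyclesIn hB.1.2
    · intro T hT
      simp only [Finset.mem_filter, Finset.mem_powerset] at hT
      rw [cyclesIn_sup hT.1]
  rw [Finset.sum_congr rfl fun σ _ => hL σ, Finset.sum_congr rfl fun σ _ => hR σ,
    Finset.sum_comm]
  conv_rhs => rw [Finset.sum_comm]
  refine Finset.sum_congr rfl fun B hB => ?_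
  replace hB : B.Nonempty := (Finset.mem_filter.1 hB).2
  have hswap : ∀ F : Perm X → ℕ,
      ∑ σ with FullCycle Finset.univ (R * σ), (if ∀ x ∈ B, σ x ∈ B then F σ else 0) =
      ∑ σ₀ : Perm X with FixesOff Bᶜ σ₀, ∑ τ : Perm X with FixesOff B τ,
        (if FullCycle Finset.univ (R * (σ₀ * τ)) then F (σ₀ * τ) else 0) := by
    intro F
    rw [← sum_invariant B fun σ => if FullCycle Finset.univ (R * σ) then F σ else 0,
      ← Finset.sum_filter, ← Finset.sum_filter, Finset.filter_filter, Finset.filter_filter]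
    refine Finset.sum_congr (Finset.filter_congr fun σ _ => and_comm) fun _ _ => rfl
  rw [hswap, hswap]
  refine Finset.sum_congr rfl fun σ₀ hσ₀ => ?_
  replace hσ₀ : FixesOff Bᶜ σ₀ := (Finset.mem_filter.1 hσ₀).2
  have key := sum_antiExc_eq_card (A := Finset.univ) (B := B) (R := R * σ₀) (r := r)
    (fun x hx => absurd (Finset.mem_univ x) hx) (Finset.subset_univ _) hB (Finset.mem_univ _)
  generalize hc : Φ (insert B (cycleSets σ₀ \ cyclesIn σ₀ B)) B = c
  have h1 : ∑ τ : Perm X with FixesOff B τ, (if FullCycle Finset.univ (R * (σ₀ * τ)) then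
        (if B ∈ cycleSets (σ₀ * τ) then antiExc (R * (σ₀ * τ)) r (σ₀ * τ) B *
          Φ (insert B (cycleSets (σ₀ * τ) \ cyclesIn (σ₀ * τ) B)) B else 0) else 0) =
      (∑ τ with FullCycle B τ, (if FullCycle Finset.univ (R * σ₀ * τ) then
        antiExc (R * σ₀ * τ) r τ B else 0)) * c := by
    rw [Finset.sum_mul, Finset.sum_filter, Finset.sum_filter]
    refine Finset.sum_congr rfl fun τ _ => ?_
    by_cases hτ : FixesOff B τ
    · have hanti : antiExc (R * σ₀ * τ) r (σ₀ * τ) B = antiExc (R * σ₀ * τ) r τ B := by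
        rw [antiExc, antiExc]
        congr 1
        exact Finset.filter_congr fun x hx => by rw [mul_apply_of_mem hσ₀ hτ hx]
      simp only [hτ, if_true, mem_cycleSets_mul_iff hσ₀ hτ hB, cycleSets_sdiff_mul hσ₀ hτ, hc,
        ← mul_assoc, hanti]
      split_ifs <;> simp
    · rw [if_neg hτ, if_neg fun h => hτ h.1]
  have h2 : ∑ τ : Perm X with FixesOff B τ, (if FullCycle Finset.univ (R * (σ₀ * τ)) then
        (if Odd (cyclesIn (σ₀ * τ) B).card then
          Φ (insert B (cycleSets (σ₀ * τ) \ cyclesIn (σ₀ * τ) B)) B else 0) else 0) =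
      (Finset.univ.filter fun τ : Perm X => FixesOff B τ ∧
        FullCycle Finset.univ (R * σ₀ * τ) ∧ Perm.sign τ = (-1) ^ (B.card + 1)).card * c := by
    rw [Finset.card_filter, Finset.sum_mul, Finset.sum_filter]
    refine Finset.sum_congr rfl fun τ _ => ?_
    by_cases hτ : FixesOff B τ
    · simp only [cycleSets_sdiff_mul hσ₀ hτ, hc]
      simp only [hτ, if_true, cyclesIn_mul hσ₀ hτ, odd_card_cyclesIn_iff hτ, ← mul_assoc,
        true_and]
      by_cases h3 : FullCycle Finset.univ (R * σ₀ * τ) <;>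
        by_cases h4 : Perm.sign τ = (-1) ^ (B.card + 1) <;> simp [h3, h4]
    · simp [hτ]
  rw [h1, h2, key]

end Gluing

section Recursion

set_option linter.unusedSectionVars false

variable {X : Type*} [DecidableEq X] [Fintype X] {A B : Finset X} {s g σ τ Q R D π : Perm X}
  {r a b p x y z : X}

theorem antiExc_univ (s : Perm X) (r : X) (σ : Perm X) :
    antiExc s r σ Finset.univ = ∑ B ∈ cycleSets σ, antiExc s r σ B := by
  simp only [antiExc]
  rw [← Finset.card_biUnion]
  · congr 1
    ext x
    simp only [Finset.mem_filter, Finset.mem_univ, true_and, Finset.mem_biUnion]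
    constructor
    · intro h
      obtain ⟨B, hB, hx⟩ := exists_mem_cycleSets σ x
      exact ⟨B, hB, hx, h⟩
    · rintro ⟨B, -, -, h⟩
      exact h
  · intro B hB B' hB' hne
    rw [Function.onFun, Finset.disjoint_left]
    intro x hx hx'
    exact hne (eq_of_mem_cycleSets hB hB' (Finset.mem_filter.1 hx).1 (Finset.mem_filter.1 hx').1)

theorem card_cycleSets_le (σ : Perm X) : (cycleSets σ).card ≤ Fintype.card X :=
  Finset.card_image_le

theorem sum_powerset_odd {ι : Type*} [DecidableEq ι] (S : Finset ι) (F : Finset ι → ℕ) {N : ℕ}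
    (hN : S.card ≤ N) :
    ∑ T ∈ S.powerset with Odd T.card, F T =
      ∑ j ∈ Finset.range (N + 1), ∑ T ∈ S.powersetCard (2 * j + 1), F T := by
  have h1 : ∀ j ∈ Finset.range (N + 1), ∑ T ∈ S.powersetCard (2 * j + 1), F T =
      ∑ T ∈ S.powerset, if T.card = 2 * j + 1 then F T else 0 := by
    intro j _
    rw [← Finset.sum_filter]
    refine Finset.sum_congr ?_ fun _ _ => rfl
    ext T
    simp [Finset.mem_powersetCard]
  rw [Finset.sum_congr rfl h1, Finset.sum_comm, Finset.sum_filter]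
  refine Finset.sum_congr rfl fun T hT => ?_
  have hTN : T.card ≤ N := (Finset.card_le_card (Finset.mem_powerset.1 hT)).trans hN
  split_ifs with hodd
  · obtain ⟨i, hi⟩ := hodd
    rw [Finset.sum_eq_single i]
    · simp [hi]
    · intro j _ hj
      rw [if_neg (by omega)]
    · intro h
      exact absurd (Finset.mem_range.2 (by omega)) h
  · symm
    refine Finset.sum_eq_zero fun j _ => ?_
    rw [if_neg fun h => hodd ⟨j, h⟩]

theorem sup_notMem_sdiff {T : Finset (Finset X)} (hT : T ⊆ cycleSets σ) (hne : T.Nonempty) :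
    T.sup id ∉ cycleSets σ \ T := by
  intro h
  rw [Finset.mem_sdiff] at h
  obtain ⟨O, hO⟩ := hne
  obtain ⟨x, hx⟩ := nonempty_of_mem_cycleSets (hT hO)
  have := eq_of_mem_cycleSets (hT hO) h.1 hx (Finset.mem_sup.2 ⟨O, hO, hx⟩)
  exact h.2 (this ▸ hO)

theorem card_sup {T : Finset (Finset X)} (hT : T ⊆ cycleSets σ) :
    (T.sup id).card = ∑ O ∈ T, O.card := by
  rw [Finset.sup_eq_biUnion, Finset.card_biUnion]
  · rfl
  · intro B hB B' hB' hne
    rw [Function.onFun, Finset.disjoint_left]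
    intro x hx hx'
    exact hne (eq_of_mem_cycleSets (hT hB) (hT hB') hx hx')

theorem image_singleton_subset_cycleSets {M : Finset X} :
    M.image (fun x => ({x} : Finset X)) ⊆ cycleSets σ ↔ ∀ x ∈ M, σ x = x := by
  simp only [Finset.image_subset_iff, singleton_mem_cycleSets]

/-- Fixing the diagonal `D`: the anti-exceedances of the verticals with `k` cycles. -/
theorem sum_antiExc_vertical (D : Perm X) (r : X) (M : Finset X) (k : ℕ) :
    ∑ π with FullCycle Finset.univ (D * π), (if (cycleSets π).card = k ∧ ∀ x ∈ M, π x = x then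
        antiExc (D * π) r π Finset.univ else 0) =
      ∑ π with FullCycle Finset.univ (D * π),
        (if (cycleSets π).card = k ∧ ∀ x ∈ M, π x = x then M.card else 0) +
      ∑ j ∈ Finset.range (Fintype.card X + 1), (k + 2 * j - M.card).choose (2 * j + 1) *
        ∑ π with FullCycle Finset.univ (D * π),
          (if (cycleSets π).card = k + 2 * j ∧ ∀ x ∈ M, π x = x then 1 else 0) := by
  set S := M.image (fun x => ({x} : Finset X)) with hS
  have hScard : S.card = M.card := Finset.card_image_of_injective _ Finset.singleton_injective
  set Φ : Finset (Finset X) → Finset X → ℕ := fun P B =>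
    if P.card = k ∧ S ⊆ P ∧ B ∉ S then 1 else 0 with hΦ
  have hleft : ∀ π : Perm X, (if (cycleSets π).card = k ∧ ∀ x ∈ M, π x = x then
        antiExc (D * π) r π Finset.univ else 0) =
      (if (cycleSets π).card = k ∧ ∀ x ∈ M, π x = x then M.card else 0) +
        ∑ B ∈ cycleSets π, antiExc (D * π) r π B * Φ (cycleSets π) B := by
    intro π
    by_cases hc : (cycleSets π).card = k ∧ ∀ x ∈ M, π x = x
    · have hSsub : S ⊆ cycleSets π := image_singleton_subset_cycleSets.2 hc.2
      rw [if_pos hc, if_pos hc, antiExc_univ, ← Finset.sum_sdiff hSsub, add_comm]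
      congr 1
      · rw [hS, Finset.sum_image (fun _ _ _ _ h => Finset.singleton_injective h),
          Finset.card_eq_sum_ones]
        refine Finset.sum_congr rfl fun x hx => ?_
        rw [antiExc, Finset.filter_true_of_mem, Finset.card_singleton]
        intro y hy
        rw [Finset.mem_singleton.1 hy, hc.2 x hx]
      · rw [← Finset.sum_sdiff hSsub, Finset.sum_eq_zero (s := S), add_zero]
        · refine Finset.sum_congr rfl fun B hB => ?_
          rw [hΦ]
          simp only [hc.1, hSsub, (Finset.mem_sdiff.1 hB).2, not_false_eq_true, and_self,
            if_true, mul_one]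
        · intro B hB
          simp [hΦ, hB]
    · rw [if_neg hc, if_neg hc, zero_add, Finset.sum_eq_zero]
      intro B _
      have : ¬ ((cycleSets π).card = k ∧ S ⊆ cycleSets π ∧ B ∉ S) := fun h =>
        hc ⟨h.1, image_singleton_subset_cycleSets.1 h.2.1⟩
      simp only [hΦ, this, if_false, mul_zero]
  have hright : ∀ π : Perm X, ∑ T ∈ (cycleSets π).powerset with Odd T.card,
        Φ (insert (T.sup id) (cycleSets π \ T)) (T.sup id) =
      ∑ j ∈ Finset.range (Fintype.card X + 1), (k + 2 * j - M.card).choose (2 * j + 1) *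
        (if (cycleSets π).card = k + 2 * j ∧ ∀ x ∈ M, π x = x then 1 else 0) := by
    intro π
    rw [sum_powerset_odd _ _ (card_cycleSets_le π)]
    refine Finset.sum_congr rfl fun j _ => ?_
    have hΦT : ∀ T ∈ (cycleSets π).powersetCard (2 * j + 1),
        Φ (insert (T.sup id) (cycleSets π \ T)) (T.sup id) =
          if ((cycleSets π).card = k + 2 * j ∧ S ⊆ cycleSets π) ∧ Disjoint T S
            then 1 else 0 := by
      intro T hT
      obtain ⟨hTsub, hTcard⟩ := Finset.mem_powersetCard.1 hT
      have hTne : T.Nonempty := Finset.card_pos.1 (by omega)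
      have hnot := sup_notMem_sdiff hTsub hTne
      have hcard : (insert (T.sup id) (cycleSets π \ T)).card + 2 * j = (cycleSets π).card := by
        rw [Finset.card_insert_of_notMem hnot, Finset.card_sdiff_of_subset hTsub, hTcard]
        have := Finset.card_le_card hTsub
        omega
      have hiff : ((insert (T.sup id) (cycleSets π \ T)).card = k ∧
          S ⊆ insert (T.sup id) (cycleSets π \ T) ∧ T.sup id ∉ S) ↔
          ((cycleSets π).card = k + 2 * j ∧ S ⊆ cycleSets π) ∧ Disjoint T S := by
        constructor
        · rintro ⟨h1, h2, h3⟩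
          have h4 := (Finset.subset_insert_iff_of_notMem h3).1 h2
          refine ⟨⟨by omega, h4.trans Finset.sdiff_subset⟩, ?_⟩
          rw [Finset.disjoint_left]
          intro O hO hOS
          exact (Finset.mem_sdiff.1 (h4 hOS)).2 hO
        · rintro ⟨⟨h1, h2⟩, h3⟩
          have h4 : S ⊆ cycleSets π \ T := fun O hO =>
            Finset.mem_sdiff.2 ⟨h2 hO, fun h => Finset.disjoint_left.1 h3 h hO⟩
          exact ⟨by omega, h4.trans (Finset.subset_insert _ _), fun h => hnot (h4 h)⟩
      simp only [hΦ, hiff]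
    rw [Finset.sum_congr rfl hΦT]
    by_cases hc : (cycleSets π).card = k + 2 * j ∧ ∀ x ∈ M, π x = x
    · have hSsub : S ⊆ cycleSets π := image_singleton_subset_cycleSets.2 hc.2
      rw [if_pos hc, mul_one, ← Finset.card_filter, ← hScard, ← hc.1,
        ← Finset.card_sdiff_of_subset hSsub, ← Finset.card_powersetCard]
      congr 1
      ext T
      simp only [Finset.mem_filter, Finset.mem_powersetCard, hSsub, and_self, true_and,
        Finset.subset_sdiff]
      tauto
    · rw [if_neg hc, mul_zero]
      refine Finset.sum_eq_zero fun T _ => ?_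
      rw [if_neg]
      rintro ⟨⟨h1, h2⟩, -⟩
      exact hc ⟨h1, image_singleton_subset_cycleSets.1 h2⟩
  rw [Finset.sum_congr rfl fun π _ => hleft π, Finset.sum_add_distrib,
    sum_antiExc_cycleSets D r Φ, Finset.sum_congr rfl fun π _ => hright π, Finset.sum_comm]
  simp only [Finset.mul_sum]

theorem fullCycle_univ_mul_comm : FullCycle Finset.univ (D * π) ↔
    FullCycle Finset.univ (π * D) := by
  have key : ∀ D π : Perm X, FullCycle Finset.univ (D * π) → FullCycle Finset.univ (π * D) := by
    intro D π h
    refine ⟨fun x hx => absurd (Finset.mem_univ x) hx, fun x _ y _ => ?_⟩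
    have h1 := (h.2 (D x) (Finset.mem_univ _) (D y) (Finset.mem_univ _)).conj (g := D⁻¹)
    simpa [mul_assoc] using h1
  exact ⟨key D π, key π D⟩

/-- Fixing the vertical `π`: the anti-exceedances of the diagonals of cycle type `L`. -/
theorem sum_antiExc_diagonal (π : Perm X) (r : X) (L : Multiset ℕ) :
    ∑ D with FullCycle Finset.univ (D * π), (if D.partition.parts = L then
        antiExc (D * π) r D Finset.univ else 0) =
      ∑ D with FullCycle Finset.univ (D * π), ∑ j ∈ Finset.range (Fintype.card X + 1),
        (D.partition.parts.powersetCard (2 * j + 1)).countP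
          (fun S => S.sum ::ₘ (D.partition.parts - S) = L) := by
  set Φ : Finset (Finset X) → Finset X → ℕ := fun P _ =>
    if P.val.map Finset.card = L then 1 else 0 with hΦ
  have hleft : ∀ D : Perm X, FullCycle Finset.univ (D * π) → (if D.partition.parts = L then
        antiExc (D * π) r D Finset.univ else 0) =
      ∑ B ∈ cycleSets D, antiExc (π * D) r D B * Φ (cycleSets D) B := by
    intro D hD
    have hoff : ∀ τ : Perm X, FixesOff Finset.univ τ := fun τ x hx =>
      absurd (Finset.mem_univ x) hx
    have h1 : antiExc (D * π) r D Finset.univ = antiExc (π * D) r D Finset.univ := by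
      rw [← antiExc_conj (D * π) D r (hoff D), ← mul_assoc, inv_mul_cancel, one_mul]
      exact antiExc_root (fullCycle_univ_mul_comm.1 hD) (hoff D) (Finset.mem_univ _)
        (Finset.mem_univ _)
    simp only [hΦ, ← partition_parts_eq]
    split_ifs
    · rw [h1, antiExc_univ]
      simp
    · simp
  have hright : ∀ D : Perm X, ∑ T ∈ (cycleSets D).powerset with Odd T.card,
        Φ (insert (T.sup id) (cycleSets D \ T)) (T.sup id) =
      ∑ j ∈ Finset.range (Fintype.card X + 1),
        (D.partition.parts.powersetCard (2 * j + 1)).countP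
          (fun S => S.sum ::ₘ (D.partition.parts - S) = L) := by
    intro D
    rw [sum_powerset_odd _ _ (card_cycleSets_le D)]
    refine Finset.sum_congr rfl fun j _ => ?_
    rw [partition_parts_eq, Multiset.powersetCard_map, ← Finset.map_val_val_powersetCard,
      Multiset.map_map, Multiset.countP_map, ← Finset.filter_val, Finset.card_val,
      Finset.card_filter]
    refine Finset.sum_congr rfl fun T hT => ?_
    obtain ⟨hTsub, hTcard⟩ := Finset.mem_powersetCard.1 hT
    have hTne : T.Nonempty := Finset.card_pos.1 (by omega)
    have h1 : (cycleSets D).val.map Finset.card - T.val.map Finset.card =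
        (cycleSets D \ T).val.map Finset.card := by
      rw [Finset.sdiff_val]
      conv_lhs => rw [← Multiset.sub_add_cancel (Finset.val_le_iff.2 hTsub), Multiset.map_add]
      exact Multiset.add_sub_cancel_right
    have h2 : (insert (T.sup id) (cycleSets D \ T)).val.map Finset.card =
        (T.val.map Finset.card).sum ::ₘ (cycleSets D \ T).val.map Finset.card := by
      rw [Finset.insert_val_of_notMem (sup_notMem_sdiff hTsub hTne), Multiset.map_cons,
        card_sup hTsub]
      rfl
    simp only [hΦ, h2, Function.comp_apply, h1]
  rw [Finset.sum_congr rfl fun D hD => hleft D (Finset.mem_filter.1 hD).2]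
  have hset : (Finset.univ.filter fun D : Perm X => FullCycle Finset.univ (D * π)) =
      Finset.univ.filter fun D => FullCycle Finset.univ (π * D) :=
    Finset.filter_congr fun D _ => fullCycle_univ_mul_comm
  rw [hset, sum_antiExc_cycleSets π r Φ, Finset.sum_congr rfl fun D _ => hright D]

end Recursion

section PlaneCount

set_option linter.unusedSectionVars false

variable {X : Type*} [DecidableEq X] [Fintype X]

/-- The number of pairs of a diagonal `D` of cycle type `L` and a vertical `π` with `k` cycles
fixing the points of `M`, whose product is a full cycle. -/
noncomputable def planeCount (M : Finset X) (L : Multiset ℕ) (k : ℕ) : ℕ :=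
  (Finset.univ.filter fun q : Perm X × Perm X => FullCycle Finset.univ (q.1 * q.2) ∧
    q.1.partition.parts = L ∧ (cycleSets q.2).card = k ∧ ∀ x ∈ M, q.2 x = x).card

theorem planeCount_eq_sum_diagonal (M : Finset X) (L : Multiset ℕ) (k : ℕ) :
    planeCount M L k = ∑ D : Perm X with D.partition.parts = L,
      ∑ π with FullCycle Finset.univ (D * π),
        (if (cycleSets π).card = k ∧ ∀ x ∈ M, π x = x then 1 else 0) := by
  rw [planeCount, Finset.card_filter, ← Finset.univ_product_univ, Finset.sum_product,
    Finset.sum_filter]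
  refine Finset.sum_congr rfl fun D _ => ?_
  rw [Finset.sum_filter]
  split_ifs with h
  · refine Finset.sum_congr rfl fun π _ => ?_
    rw [← ite_and]
    simp only [h, true_and]
  · simp [h]

theorem sum_diagonal_vertical {N : Type*} [AddCommMonoid N] (p q : Perm X → Prop)
    [DecidablePred p] [DecidablePred q] (F : Perm X → Perm X → N) :
    ∑ D with p D, ∑ π with FullCycle Finset.univ (D * π), (if q π then F D π else 0) =
      ∑ π with q π, ∑ D with FullCycle Finset.univ (D * π), (if p D then F D π else 0) := by
  have h1 : ∀ D, ∑ π with FullCycle Finset.univ (D * π), (if q π then F D π else 0) =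
      ∑ π with q π, if FullCycle Finset.univ (D * π) then F D π else 0 := by
    intro D
    rw [← Finset.sum_filter, ← Finset.sum_filter, Finset.filter_filter, Finset.filter_filter]
    exact Finset.sum_congr (Finset.filter_congr fun _ _ => and_comm) fun _ _ => rfl
  have h2 : ∀ π, ∑ D with FullCycle Finset.univ (D * π), (if p D then F D π else 0) =
      ∑ D with p D, if FullCycle Finset.univ (D * π) then F D π else 0 := by
    intro π
    rw [← Finset.sum_filter, ← Finset.sum_filter, Finset.filter_filter, Finset.filter_filter]
    exact Finset.sum_congr (Finset.filter_congr fun _ _ => and_comm) fun _ _ => rfl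
  rw [Finset.sum_congr rfl fun D _ => h1 D, Finset.sum_congr rfl fun π _ => h2 π, Finset.sum_comm]

theorem planeCount_eq_sum_vertical (M : Finset X) (L : Multiset ℕ) (k : ℕ) :
    planeCount M L k = ∑ π : Perm X with (cycleSets π).card = k ∧ ∀ x ∈ M, π x = x,
      ∑ D with FullCycle Finset.univ (D * π), (if D.partition.parts = L then 1 else 0) := by
  rw [planeCount_eq_sum_diagonal, sum_diagonal_vertical]

theorem planeCount_eq_zero {M : Finset X} {k : ℕ} (L : Multiset ℕ) (hk : k < M.card) :
    planeCount M L k = 0 := by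
  rw [planeCount, Finset.card_eq_zero, Finset.filter_eq_empty_iff]
  rintro ⟨D, π⟩ - ⟨-, -, h1, h2⟩
  have := Finset.card_le_card (image_singleton_subset_cycleSets.2 h2)
  rw [Finset.card_image_of_injective _ Finset.singleton_injective] at this
  omega

/-- Regrouping a sum over permutations by cycle type. -/
theorem sum_partition_parts {S : Finset (Multiset ℕ)} (hS : ∀ D : Perm X, D.partition.parts ∈ S)
    (M : Finset X) (k : ℕ) (c : Multiset ℕ → ℕ) :
    ∑ π : Perm X with (cycleSets π).card = k ∧ ∀ x ∈ M, π x = x,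
        ∑ D with FullCycle Finset.univ (D * π), c D.partition.parts =
      ∑ P ∈ S, c P * planeCount M P k := by
  simp only [planeCount_eq_sum_vertical, Finset.mul_sum]
  rw [Finset.sum_comm]
  refine Finset.sum_congr rfl fun π _ => ?_
  rw [Finset.sum_comm]
  refine Finset.sum_congr rfl fun D _ => ?_
  rw [Finset.sum_eq_single D.partition.parts]
  · simp
  · intro P _ hne
    rw [if_neg hne.symm, mul_zero]
  · intro h
    exact absurd (hS D) h

theorem card_add_one_mul_planeCount (r : X) {S : Finset (Multiset ℕ)}
    (hS : ∀ D : Perm X, D.partition.parts ∈ S) (M : Finset X) (L : Multiset ℕ) (k : ℕ) :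
    (Fintype.card X + 1) * planeCount M L k = M.card * planeCount M L k +
      ∑ j ∈ Finset.range (Fintype.card X + 1), (k + 2 * j - M.card).choose (2 * j + 1) *
        planeCount M L (k + 2 * j) +
      ∑ j ∈ Finset.range (Fintype.card X + 1), ∑ P ∈ S,
        (P.powersetCard (2 * j + 1)).countP (fun S => S.sum ::ₘ (P - S) = L) *
          planeCount M P k := by
  have hoff : ∀ τ : Perm X, FixesOff Finset.univ τ := fun τ x hx =>
    absurd (Finset.mem_univ x) hx
  have h1 : (Fintype.card X + 1) * planeCount M L k =
      ∑ D : Perm X with D.partition.parts = L, ∑ π with FullCycle Finset.univ (D * π),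
        (if (cycleSets π).card = k ∧ ∀ x ∈ M, π x = x then
          antiExc (D * π) r π Finset.univ else 0) +
      ∑ D : Perm X with D.partition.parts = L, ∑ π with FullCycle Finset.univ (D * π),
        (if (cycleSets π).card = k ∧ ∀ x ∈ M, π x = x then
          antiExc (D * π) r D Finset.univ else 0) := by
    rw [planeCount_eq_sum_diagonal, Finset.mul_sum, ← Finset.sum_add_distrib]
    refine Finset.sum_congr rfl fun D _ => ?_
    rw [Finset.mul_sum, ← Finset.sum_add_distrib]
    refine Finset.sum_congr rfl fun π hπ => ?_
    have := antiExc_add_antiExc (Finset.mem_filter.1 hπ).2 (hoff π) (Finset.mem_univ r)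
    rw [Finset.card_univ] at this
    split_ifs
    · rw [this, mul_one]
    · rfl
  rw [h1]
  congr 1
  · rw [Finset.sum_congr rfl fun D _ => sum_antiExc_vertical D r M k, Finset.sum_add_distrib]
    congr 1
    · rw [planeCount_eq_sum_diagonal, Finset.mul_sum]
      refine Finset.sum_congr rfl fun D _ => ?_
      rw [Finset.mul_sum]
      simp only [mul_ite, mul_one, mul_zero]
    · rw [Finset.sum_comm]
      refine Finset.sum_congr rfl fun j _ => ?_
      rw [planeCount_eq_sum_diagonal, Finset.mul_sum]
  · rw [sum_diagonal_vertical, Finset.sum_congr rfl fun π _ => sum_antiExc_diagonal π r L,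
      sum_partition_parts hS M k fun P => ∑ j ∈ Finset.range (Fintype.card X + 1),
        (P.powersetCard (2 * j + 1)).countP fun S => S.sum ::ₘ (P - S) = L, Finset.sum_comm]
    simp only [Finset.sum_mul]

theorem countP_powersetCard_one (P L : Multiset ℕ) :
    (P.powersetCard 1).countP (fun S => S.sum ::ₘ (P - S) = L) =
      if P = L then P.card else 0 := by
  rw [Multiset.powersetCard_one, Multiset.countP_map,
    Multiset.filter_congr (q := fun _ => P = L)]
  · split_ifs with h <;> simp [h]
  · intro a ha
    rw [Multiset.sum_singleton, Multiset.sub_singleton, Multiset.cons_erase ha]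

end PlaneCount

section Partitions

variable {n : ℕ}

theorem mergeCount_one (mu lam : n.Partition) :
    mergeCount 1 mu lam = if mu = lam then mu.parts.card else 0 := by
  rw [mergeCount, countP_powersetCard_one]
  simp only [Nat.Partition.ext_iff]

theorem splitsInto_of_mergeCount_ne_zero {r : ℕ} {mu lam : n.Partition}
    (h : mergeCount r mu lam ≠ 0) : SplitsInto r mu lam := by
  obtain ⟨S, hS, heq⟩ := Multiset.countP_pos.1 (Nat.pos_of_ne_zero h)
  obtain ⟨hle, hcard⟩ := Multiset.mem_powersetCard.1 hS
  refine ⟨S.sum, ?_, S, hcard, rfl, ?_⟩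
  · rw [← heq]
    exact Multiset.mem_cons_self _ _
  · rw [← heq, Multiset.erase_cons_head, Multiset.sub_add_cancel hle]

theorem sum_splitsInto (r : ℕ) (lam : n.Partition) (F : n.Partition → ℕ) :
    ∑ mu : n.Partition with SplitsInto r mu lam, mergeCount r mu lam * F mu =
      ∑ mu : n.Partition, mergeCount r mu lam * F mu := by
  refine Finset.sum_filter_of_ne fun mu _ h => ?_
  exact splitsInto_of_mergeCount_ne_zero (left_ne_zero_of_mul h)

theorem isolatedNumber_eq_planeCount (lam : n.Partition) (m k : ℕ) :
    isolatedNumber lam m k =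
      planeCount (Finset.univ.filter fun i : Fin n => i.val < m) lam.parts k := by
  rw [isolatedNumber, planeCount, ← Set.ncard_coe_finset]
  have hfull : ∀ s : Perm (Fin n), FullCycle Finset.univ s ↔ s.IsCycleOn Set.univ := by
    intro s
    constructor
    · intro h
      exact ⟨s.bijective.bijOn_univ, fun x _ y _ => h.2 x (Finset.mem_univ _) y
        (Finset.mem_univ _)⟩
    · intro h
      exact ⟨fun x hx => absurd (Finset.mem_univ x) hx, fun x _ y _ => h.2 trivial trivial⟩
  refine Set.ncard_congr (fun p _ => (p.diagonal, p.vertical)) ?_ ?_ ?_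
  · rintro ⟨⟨s, π⟩, hs⟩ ⟨h1, h2, h3⟩
    simp only [PlanePerm.diagonal, PlanePerm.vertical, PlanePerm.upper, HasCycleType,
      numCycles] at h1 h2 h3 ⊢
    simp only [Finset.coe_filter, Finset.mem_univ, true_and, Finset.mem_filter]
    refine ⟨?_, h1, by rw [card_cycleSets, h2], h3⟩
    rw [inv_mul_cancel_right]
    exact (hfull s).2 hs
  · rintro ⟨⟨s, π⟩, hs⟩ ⟨⟨s', π'⟩, hs'⟩ - - heq
    simp only [PlanePerm.diagonal, PlanePerm.vertical, PlanePerm.upper, Prod.mk.injEq] at heq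
    obtain ⟨h1, rfl⟩ := heq
    simp only [mul_right_cancel h1]
  · rintro ⟨D, π⟩ h
    simp only [Finset.coe_filter, Finset.mem_univ, true_and, Finset.mem_filter] at h
    obtain ⟨h0, h1, h2, h3⟩ := h
    refine ⟨⟨(D * π, π), (hfull _).1 h0⟩, ⟨?_, ?_, h3⟩, ?_⟩
    · simpa [PlanePerm.diagonal, PlanePerm.vertical, PlanePerm.upper, HasCycleType] using h1
    · rw [numCycles, ← card_cycleSets]
      exact h2
    · simp [PlanePerm.diagonal, PlanePerm.vertical, PlanePerm.upper]

end Partitions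

theorem mainTheorem10 (n m k : ℕ) (hn : 1 ≤ n) (hm : m ≤ n) (lam : n.Partition)
    (hpos : lam.parts.card + k < n + 1) :
    (isolatedNumber lam m k : ℚ) =
      ((∑ j ∈ Finset.Icc 1 n,
            ((k + 2 * j - m).choose (2 * j + 1) : ℚ) * (isolatedNumber lam m (k + 2 * j) : ℚ)) +
          ∑ j ∈ Finset.Icc 1 n,
            ∑ mu : n.Partition with SplitsInto (2 * j + 1) mu lam,
              (mergeCount (2 * j + 1) mu lam : ℚ) * (isolatedNumber mu m k : ℚ)) /
        ((n : ℚ) + 1 - (lam.parts.card : ℚ) - (k : ℚ)) := by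
  have hMcard : (Finset.univ.filter fun i : Fin n => i.val < m).card = m := by
    rw [Fin.card_filter_val_lt, min_eq_right hm]
  have hinj : Function.Injective (Nat.Partition.parts (n := n)) := fun _ _ => Nat.Partition.ext
  have hS : ∀ D : Perm (Fin n), D.partition.parts ∈
      Finset.univ.image (Nat.Partition.parts (n := n)) := fun D =>
    Finset.mem_image.2 ⟨⟨D.partition.parts, D.partition.parts_pos,
      by rw [D.partition.parts_sum, Fintype.card_fin]⟩, Finset.mem_univ _, rfl⟩
  have key := card_add_one_mul_planeCount (⟨0, hn⟩ : Fin n) hS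
    (Finset.univ.filter fun i : Fin n => i.val < m) lam.parts k
  simp only [Finset.sum_image hinj.injOn] at key
  rw [Fintype.card_fin, hMcard] at key
  have hsmall : k < m → isolatedNumber lam m k = 0 := fun h => by
    rw [isolatedNumber_eq_planeCount]
    exact planeCount_eq_zero _ (by rwa [hMcard])
  have hmerge : ∀ (r : ℕ) (mu : n.Partition), (mu.parts.powersetCard r).countP
      (fun S => S.sum ::ₘ (mu.parts - S) = lam.parts) = mergeCount r mu lam := fun _ _ => rfl
  simp only [← isolatedNumber_eq_planeCount, hmerge] at key
  have hrange : ∀ f : ℕ → ℕ, ∑ j ∈ Finset.range (n + 1), f j = f 0 + ∑ j ∈ Finset.Icc 1 n, f j := by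
    intro f
    rw [Finset.range_eq_Ico, Finset.sum_eq_sum_Ico_succ_bot (Nat.succ_pos n)]
    rfl
  have hzero : ∑ mu : n.Partition, mergeCount (2 * 0 + 1) mu lam * isolatedNumber mu m k =
      lam.parts.card * isolatedNumber lam m k := by
    simp [mergeCount_one]
  rw [hrange, hrange, hzero, mul_zero, add_zero, zero_add, Nat.choose_one_right] at key
  simp only [← sum_splitsInto] at key
  have hmk : m * isolatedNumber lam m k + (k - m) * isolatedNumber lam m k =
      k * isolatedNumber lam m k := by
    rcases lt_or_ge k m with h | h
    · rw [hsmall h]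
      simp
    · rw [← add_mul, Nat.add_sub_cancel' h]
  have hden : (0 : ℚ) < (n : ℚ) + 1 - (lam.parts.card : ℚ) - (k : ℚ) := by
    have : ((lam.parts.card + k : ℕ) : ℚ) < ((n + 1 : ℕ) : ℚ) := Nat.cast_lt.2 hpos
    push_cast at this
    linarith
  rw [eq_div_iff hden.ne']
  have keyQ := congrArg (Nat.cast : ℕ → ℚ) key
  have hmkQ := congrArg (Nat.cast : ℕ → ℚ) hmk
  push_cast at keyQ hmkQ
  linarith
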